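/- Let $X=(X_n:n\ge 0)$ be an irreducible, positive recurrent Markov chain on a finite or countably infinite state space $S$, with one-step transition matrix $P=(P(x,y):x,y\in S)$ and (unique) stationary distribution $\pi=(\pi(x):x\in S)$. Write $P_x$ and $E_x$ for probability and expectation given $X_0=x$, and put $\tau(z)=\inf\{n\ge 1: X_n=z\}$ for $z\in S$. Let $f:S\to\mathbb R$ satisfy $f\in L^1(\pi)$, that is, $\sum_{x\in S}\pi(x)|f(x)|<\infty$, and put $\pi f=\sum_{x\in S}\pi(x)f(x)$ and $f_c(x)=f(x)-\pi f$ for $x\in S$. Suppose that there exists $z\in S$ for which $$E_z\sum_{j=0}^{\tau(z)-1} j\,|f_c(X_j)|<\infty\qquad\text{and}\qquad E_z\,\tau(z)^2<\infty .$$ If $X$ is aperiodic, then for every $x\in S$ the expectations $E_xf_c(X_n)$, $n\ge 0$, exist (as $E_x|f_c(X_n)|<\infty$) and $$\sum_{n=0}^{\infty}\bigl|E_xf_c(X_n)\bigr|<\infty .$$ Consequently, the function $g^*(x)=\sum_{n=0}^{\infty}E_xf_c(X_n)$, $x\in S$, is well defined and finite-valued, and it solves Poisson's equation for $f_c$: for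 every $x\in S$ the series $(Pg^*)(x)=\sum_{y\in S}P(x,y)g^*(y)$ converges absolutely, and $$(Pg^*)(x)-g^*(x)=-f_c(x).$$ -/

import Mathlib

open MeasureTheory
open scoped ENNReal

namespace CountableChain

variable {S Ω : Type*}

/-- `P` is a transition matrix on the countable state space `S`. -/
structure IsTransitionMatrix (P : S → S → ℝ) : Prop where
  nonneg : ∀ x y, 0 ≤ P x y
  row_sum : ∀ x, HasSum (fun y => P x y) 1

/-- `X` is a Markov chain with transition matrix `P`, and `μ x` is the law `P_x` under which
the chain starts at `x`: each `μ x` is a probability measure, `X 0 = x` holds `μ x`-almost surely,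
and conditionally on `X 0, …, X n` the next state has distribution `P (X n) ·`. -/
structure IsMarkovChain [MeasurableSpace S] [MeasurableSpace Ω]
    (P : S → S → ℝ) (X : ℕ → Ω → S) (μ : S → Measure Ω) : Prop where
  isProbabilityMeasure : ∀ x, IsProbabilityMeasure (μ x)
  measurable : ∀ n, Measurable (X n)
  start : ∀ x, ∀ᵐ ω ∂(μ x), X 0 ω = x
  markov : ∀ (x : S) (n : ℕ) (s : ℕ → S) (y : S),
    μ x {ω | (∀ k ≤ n, X k ω = s k) ∧ X (n + 1) ω = y}
      = μ x {ω | ∀ k ≤ n, X k ω = s k} * ENNReal.ofReal (P (s n) y)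

/-- The first return time `τ(z) = inf {n ≥ 1 : X n = z}`, equal to `⊤` if there is no such `n`. -/
noncomputable def returnTime (X : ℕ → Ω → S) (z : S) (ω : Ω) : ℕ∞ :=
  hittingAfter X {z} 1 ω

/-- Every state can be reached from every state with positive probability. -/
def IsIrreducible [MeasurableSpace Ω] (X : ℕ → Ω → S) (μ : S → Measure Ω) : Prop :=
  ∀ x y, ∃ n : ℕ, 0 < μ x {ω | X n ω = y}

/-- Every state has a finite mean return time. -/
def IsPositiveRecurrent [MeasurableSpace Ω] (X : ℕ → Ω → S) (μ : S → Measure Ω) : Prop :=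
  ∀ z, ∫⁻ ω, (returnTime X z ω : ℝ≥0∞) ∂(μ z) < ∞

/-- For every state `x`, the greatest common divisor of `{n ≥ 1 : P_x(X n = x) > 0}` is `1`. -/
def IsAperiodic [MeasurableSpace Ω] (X : ℕ → Ω → S) (μ : S → Measure Ω) : Prop :=
  ∀ x, ∀ d : ℕ, (∀ n : ℕ, 1 ≤ n → 0 < μ x {ω | X n ω = x} → d ∣ n) → d = 1

/-- `π` is a stationary distribution of the transition matrix `P`. -/
structure IsStationary (P : S → S → ℝ) (π : S → ℝ) : Prop where
  nonneg : ∀ x, 0 ≤ π x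
  hasSum_one : HasSum π 1
  stationary : ∀ y, HasSum (fun x => π x * P x y) (π y)

/-- `f ∈ L¹(π)`. -/
def MemL1 (π f : S → ℝ) : Prop :=
  Summable fun x => π x * |f x|

/-- The centered function `f_c = f - π f`. -/
noncomputable def centered (π f : S → ℝ) (x : S) : ℝ :=
  f x - ∑' y, π y * f y

/-- `E_z ∑_{j=0}^{τ(z)-1} j |h(X j)| < ∞`. -/
def MomentCondition [MeasurableSpace Ω] (X : ℕ → Ω → S) (μ : S → Measure Ω)
    (h : S → ℝ) (z : S) : Prop :=
  ∫⁻ ω, ∑' j : ℕ,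
    (if (j : ℕ∞) < returnTime X z ω then (j : ℝ≥0∞) * ENNReal.ofReal |h (X j ω)| else 0) ∂(μ z) < ∞

/-- `g` solves Poisson's equation `(P - I) g = -h`; part of the claim is that the series
`(P g)(x) = ∑_y P(x,y) g(y)` converge absolutely. -/
def SolvesPoisson (P : S → S → ℝ) (h g : S → ℝ) : Prop :=
  ∀ x, Summable (fun y => P x y * g y) ∧ (∑' y, P x y * g y) - g x = -h x

/-- The series `∑_{n ≥ 0} E_x h(X n)`. -/
noncomputable def potential [MeasurableSpace Ω] (X : ℕ → Ω → S) (μ : S → Measure Ω)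
    (h : S → ℝ) (x : S) : ℝ :=
  ∑' n : ℕ, ∫ ω, h (X n ω) ∂(μ x)

end CountableChain

/-! Let `h` be the centered function and split paths at visits to `z`. With `u n = P^n(z,z)` and `a
n = E_z[h(X_n); n < τ(z)]`, decomposing at the last visit to `z` up to time `n` gives `E_z h(X_n) =
∑ i ≤ n, u i * a (n - i)`. The stationary law is the normalized occupation measure of a cycle, so `∑
a n = 0`, and the moment condition gives `∑ n |a n| < ∞`. As power series, `u * a = ((1 - X) u) * (a
/ (1 - X))`, so it suffices that both factors on the right are absolutely summable. The second
factor consists of the partial sums of `a`, which are minus its tails, and these are summable by the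
first moment (`summable_abs_partial_sums`).

For the first factor, let `r n = P_z(τ(z) > n)`. Since some last visit to `z` up to time `n` always
exists, `u * r = 1 / (1 - X)`, so `(1 - X) u` is the inverse of `r`. The second moment of `τ(z)`
gives `∑ n r n < ∞`, so `r` defines a `C¹` function on the unit circle; aperiodicity excludes zeros
there (`tsum_mul_pow_ne_zero_of_renewal`). Its reciprocal is `C¹` and so has absolutely summable
Fourier coefficients, which are identified with the increments of `u`
(`summable_norm_of_convolution_eq_delta`).

A general start `x` is reduced to `z` by decomposing at the first visit to `z`: the part before that
visit costs at most `cycleSum`, which is finite because every `x` is reached from `z` within a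
cycle. Poisson's equation then follows by Fubini, shifting the series by one step. -/

/-! ### Inversion of absolutely convergent series on the unit circle -/

/-- Integration by parts, with boundary term killed by periodicity, bounds the `n`-th coefficient by
that of `F'` over `|n|`. Both `1 / |n|` and the coefficients of `F'` are square summable, the latter
by Parseval. -/
theorem summable_norm_fourierCoeffOn_of_hasDerivAt {F F' : ℝ → ℂ}
    (hF : ∀ x, HasDerivAt F (F' x) x) (hF' : Continuous F') (hper : F 1 = F 0) :
    Summable fun n : ℤ => ‖fourierCoeffOn zero_lt_one F n‖ := by
  have hL2 : MemLp F' 2 (volume.restrict (Set.Ioc (0 : ℝ) 1)) := by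
    obtain ⟨C, hC⟩ := isCompact_Icc.exists_bound_of_continuousOn
      (s := Set.Icc (0 : ℝ) 1) hF'.continuousOn
    refine MemLp.of_bound hF'.aestronglyMeasurable C ?_
    exact (ae_restrict_mem measurableSet_Ioc).mono fun x hx => hC x (Set.Ioc_subset_Icc_self hx)
  have h1 := (hasSum_sq_fourierCoeffOn zero_lt_one hL2).summable
  have h2 : Summable fun n : ℤ => 1 / (n : ℝ) ^ 2 := by
    simpa using Real.summable_one_div_int_pow.2 (show 1 < 2 by norm_num)
  refine Summable.of_norm_bounded_eventually (h1.add h2) ?_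
  have h0 : ∀ᶠ n : ℤ in Filter.cofinite, n ≠ 0 := by
    simpa using (Set.finite_singleton (0 : ℤ)).compl_mem_cofinite
  filter_upwards [h0] with n hn
  rw [fourierCoeffOn_of_hasDerivAt zero_lt_one hn (fun x _ => hF x) (hF'.intervalIntegrable _ _),
    hper]
  set c := ‖fourierCoeffOn zero_lt_one F' n‖ with hc
  have hn' : (0 : ℝ) < |(n : ℝ)| := by positivity
  have e : ‖1 / (-2 * (Real.pi : ℂ) * Complex.I * n) *
      (fourier (-n) ((0 : ℝ) : AddCircle ((1 : ℝ) - 0)) * (F 0 - F 0) -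
        ((1 : ℝ) - (0 : ℝ) : ℂ) * fourierCoeffOn zero_lt_one F' n)‖ = 1 / (2 * Real.pi * |(n : ℝ)|) * c := by
    simp [hc, abs_of_pos Real.pi_pos]
  rw [norm_norm, e]
  have h3 : 1 / (2 * Real.pi * |(n : ℝ)|) ≤ 1 / |(n : ℝ)| := by
    apply one_div_le_one_div_of_le hn'
    nlinarith [Real.pi_gt_three]
  have h4 : (1 / |(n : ℝ)|) ^ 2 = 1 / (n : ℝ) ^ 2 := by rw [div_pow, sq_abs, one_pow]
  have hc0 : 0 ≤ c := norm_nonneg _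
  -- The product `c / |n|` is at most `1 / n² + c²`.
  nlinarith [sq_nonneg (1 / |(n : ℝ)| - c), mul_le_mul_of_nonneg_right h3 hc0, sq_nonneg c,
    sq_nonneg (1 / |(n : ℝ)|)]

theorem fourierCoeffOn_zero_one (F : ℝ → ℂ) (n : ℤ) :
    fourierCoeffOn zero_lt_one F n =
      ∫ x in (0 : ℝ)..1, Complex.exp (2 * Real.pi * Complex.I * (-n) * x) * F x := by
  rw [fourierCoeffOn_eq_integral]
  simp only [fourier_coe_apply]
  simp

theorem integral_exp_two_pi_int (n : ℤ) :
    ∫ x in (0 : ℝ)..1, Complex.exp (2 * Real.pi * Complex.I * (-n) * x) = if n = 0 then 1 else 0 := by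
  split_ifs with h
  · simp [h]
  · have : (2 * Real.pi * Complex.I * (-n) : ℂ) ≠ 0 := by
      simp [h, Real.pi_ne_zero]
    rw [integral_exp_mul_complex this]
    have : Complex.exp (2 * Real.pi * Complex.I * (-n)) = 1 := by
      rw [Complex.exp_eq_one_iff]
      exact ⟨-n, by push_cast; ring⟩
    simp only [Complex.ofReal_one, mul_one, this]
    simp

theorem norm_exp_two_pi_I_mul (n x : ℝ) :
    ‖Complex.exp (2 * Real.pi * Complex.I * n * x)‖ = 1 := by
  rw [Complex.norm_exp]
  simp

/-- A power series with `∑ n ‖r n‖ < ∞` and without zeros on the unit circle has an inverse with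
absolutely summable coefficients there. -/
theorem exists_summable_convolution_inverse {r : ℕ → ℂ} (hr : Summable fun n : ℕ => n * ‖r n‖)
    (hne : ∀ ζ : ℂ, ‖ζ‖ = 1 → ∑' n, r n * ζ ^ n ≠ 0) :
    ∃ c : ℤ → ℂ, Summable (fun n => ‖c n‖) ∧
      ∀ n : ℤ, HasSum (fun j : ℕ => r j * c (n - j)) (if n = 0 then 1 else 0) := by
  have hr0 : Summable fun n => ‖r n‖ := by
    refine Summable.of_norm_bounded_eventually_nat hr ?_
    filter_upwards [Filter.eventually_ge_atTop 1] with n hn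
    rw [norm_norm]
    exact le_mul_of_one_le_left (norm_nonneg _) (by exact_mod_cast hn)
  let g : ℕ → ℝ → ℂ := fun n x => r n * Complex.exp (2 * Real.pi * Complex.I * n * x)
  let g' : ℕ → ℝ → ℂ := fun n x =>
    r n * (Complex.exp (2 * Real.pi * Complex.I * n * x) * (2 * Real.pi * Complex.I * n))
  have hg : ∀ n x, HasDerivAt (g n) (g' n x) x := by
    intro n x
    have h : HasDerivAt (fun y : ℂ => r n * Complex.exp (2 * Real.pi * Complex.I * n * y)) (g' n x) x := by
      refine HasDerivAt.const_mul _ (HasDerivAt.cexp ?_)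
      simpa using (hasDerivAt_id (x : ℂ)).const_mul (2 * Real.pi * Complex.I * n : ℂ)
    exact h.comp_ofReal
  have hnorm : ∀ (n : ℕ) (x : ℝ), ‖Complex.exp (2 * Real.pi * Complex.I * n * x)‖ = 1 := fun n x => by
    exact_mod_cast norm_exp_two_pi_I_mul n x
  have hgb : ∀ n x, ‖g n x‖ ≤ ‖r n‖ := fun n x => by simp [g, hnorm]
  have hu : Summable fun n : ℕ => 2 * Real.pi * (n * ‖r n‖) := hr.mul_left _
  have hg'b : ∀ n x, ‖g' n x‖ ≤ 2 * Real.pi * (n * ‖r n‖) := fun n x => by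
    simp only [g', norm_mul, hnorm]
    simp [abs_of_pos Real.pi_pos]
    apply le_of_eq; ring
  have hgs : ∀ x, Summable fun n => g n x := fun x => Summable.of_norm_bounded hr0 fun n => hgb n x
  let ρ : ℝ → ℂ := fun x => ∑' n, g n x
  let ρ' : ℝ → ℂ := fun x => ∑' n, g' n x
  have hρ : ∀ x, HasDerivAt ρ (ρ' x) x := fun x => hasDerivAt_tsum hu hg hg'b (hgs 0) x
  have hρ'c : Continuous ρ' := continuous_tsum (fun n => by fun_prop) hu hg'b
  have hρc : Continuous ρ := continuous_iff_continuousAt.2 fun x => (hρ x).continuousAt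
  have hρ0 : ∀ x, ρ x ≠ 0 := by
    intro x
    have h := hne (Complex.exp (2 * Real.pi * Complex.I * x)) (by
      simpa using norm_exp_two_pi_I_mul 1 x)
    convert h using 4 with n
    rw [← Complex.exp_nat_mul]
    congr 1; ring
  let F : ℝ → ℂ := fun x => (ρ x)⁻¹
  have hF : ∀ x, HasDerivAt F (-ρ' x / ρ x ^ 2) x := fun x => (hρ x).fun_inv (hρ0 x)
  have hFc : Continuous F := hρc.inv₀ hρ0
  have hper : F 1 = F 0 := by
    simp only [F, ρ, g]
    congr 3 with n
    congr 1
    rw [Complex.ofReal_zero, mul_zero, Complex.exp_zero, Complex.exp_eq_one_iff]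
    exact ⟨n, by push_cast; ring⟩
  refine ⟨fun n => fourierCoeffOn zero_lt_one F n,
    summable_norm_fourierCoeffOn_of_hasDerivAt hF ?_ hper, fun n => ?_⟩
  · exact (hρ'c.neg).div (hρc.pow 2) fun x => pow_ne_zero 2 (hρ0 x)
  · obtain ⟨M, hM⟩ := isCompact_Icc.exists_bound_of_continuousOn
      (s := Set.Icc (0 : ℝ) 1) hFc.continuousOn
    -- Since `ρ * F = 1`, the function `e^{-2πinx}` equals `∑ j, r j * e^{-2πi(n-j)x} * F x`.
    -- Integrating termwise gives the convolution identity for the Fourier coefficients of `F =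
    -- 1/ρ`.
    have key := intervalIntegral.hasSum_integral_of_dominated_convergence (μ := volume)
      (a := (0 : ℝ)) (b := 1)
      (F := fun (j : ℕ) x => r j * (Complex.exp (2 * Real.pi * Complex.I * (-(n - j : ℤ)) * x) * F x))
      (f := fun x => Complex.exp (2 * Real.pi * Complex.I * (-n) * x))
      (fun j _ => ‖r j‖ * M) (fun j => by
        refine Continuous.aestronglyMeasurable ?_
        fun_prop)
      (fun j => ae_of_all _ fun x hx => by
        rw [Set.uIoc_of_le zero_le_one] at hx
        rw [norm_mul, norm_mul]
        have := norm_exp_two_pi_I_mul (-(n - j : ℤ)) x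
        push_cast at this ⊢
        rw [this, one_mul]
        exact mul_le_mul_of_nonneg_left (hM x (Set.Ioc_subset_Icc_self hx)) (norm_nonneg _))
      (ae_of_all _ fun x _ => hr0.mul_right M)
      (by simp)
      (ae_of_all _ fun x _ => by
        have h := ((hgs x).hasSum.mul_right (F x)).mul_left
          (Complex.exp (2 * Real.pi * Complex.I * (-n) * x))
        have e : (∑' n, g n x) * F x = 1 := mul_inv_cancel₀ (hρ0 x)
        rw [e, mul_one] at h
        refine h.congr_fun ?_ 
        intro j
        simp only [g]
        have : Complex.exp (2 * Real.pi * Complex.I * (-(n - j : ℤ)) * x) =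
            Complex.exp (2 * Real.pi * Complex.I * (-n) * x) *
              Complex.exp (2 * Real.pi * Complex.I * j * x) := by
          rw [← Complex.exp_add]; congr 1; push_cast; ring
        rw [this]; ring)
    rw [integral_exp_two_pi_int] at key
    simpa only [fourierCoeffOn_zero_one, intervalIntegral.integral_const_mul] using key

/-- A bounded one-sided inverse must agree with the summable two-sided inverse `c`: associativity
`(c * r) * d = c * (r * d)` is legitimate because `c` and `r` are summable and `d` is bounded. -/
theorem summable_norm_of_convolution_eq_delta {r d : ℕ → ℂ}
    (hr : Summable fun n : ℕ => n * ‖r n‖)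
    (hne : ∀ ζ : ℂ, ‖ζ‖ = 1 → ∑' n, r n * ζ ^ n ≠ 0) {B : ℝ} (hd : ∀ n, ‖d n‖ ≤ B)
    (hrd : ∀ n, ∑ p ∈ Finset.HasAntidiagonal.antidiagonal n, r p.1 * d p.2 = if n = 0 then 1 else 0) :
    Summable fun n => ‖d n‖ := by
  obtain ⟨c, hc, hrc⟩ := exists_summable_convolution_inverse hr hne
  have hr0 : Summable fun n => ‖r n‖ := by
    refine Summable.of_norm_bounded_eventually_nat hr ?_
    filter_upwards [Filter.eventually_ge_atTop 1] with n hn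
    rw [norm_norm]
    exact le_mul_of_one_le_left (norm_nonneg _) (by exact_mod_cast hn)
  have hdc : ∀ n : ℕ, d n = c n := by
    intro n
    let G : ℕ × ℕ → ℂ := fun p => c (n - (p.1 + p.2 : ℕ)) * (r p.1 * d p.2)
    have hcr : Summable fun p : ℤ × ℕ => c p.1 * r p.2 := summable_mul_of_summable_norm hc hr0
    -- For fixed `n`, the pair `(j, k)` is determined by `(n - j - k, j)`, so `G` is dominated by
    -- `B` times a subfamily of the summable family `c ⊗ r`.
    have hinj : Function.Injective fun p : ℕ × ℕ => ((n - (p.1 + p.2 : ℕ) : ℤ), p.1) := by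
      rintro ⟨a, b⟩ ⟨a', b'⟩ h
      simp only [Prod.mk.injEq] at h ⊢
      omega
    have hG : Summable G := by
      refine Summable.of_norm_bounded (((hcr.comp_injective hinj).norm).mul_left B) fun p => ?_
      simp only [G, Function.comp, norm_mul]
      rw [← mul_assoc, mul_comm]
      exact mul_le_mul_of_nonneg_right (hd _) (by positivity)
    -- Summing over `j` first uses `c * r = δ`; summing `G` along antidiagonals, in `e2`, uses `r *
    -- d = δ`.
    have e1 : ∑' p, G p = d n := by
      have hG' := (Equiv.prodComm ℕ ℕ).summable_iff.2 hG
      rw [← (Equiv.prodComm ℕ ℕ).tsum_eq G]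
      have := hG'.tsum_prod' (fun k => hG'.prod_factor k)
      simp only [Function.comp_apply] at this
      rw [this]
      have h2 : ∀ k, ∑' j, G (Equiv.prodComm ℕ ℕ (k, j)) = if k = n then d n else 0 := by
        intro k
        have := ((hrc (n - k)).mul_right (d k)).tsum_eq
        have e : ∀ j : ℕ, G (Equiv.prodComm ℕ ℕ (k, j)) = r j * c (n - k - j) * d k := by
          intro j
          simp only [G, Equiv.prodComm_apply, Prod.swap]
          rw [show ((n : ℤ) - (j + k : ℕ)) = n - k - j by push_cast; ring]; ring
        simp only [e, this]
        by_cases h : k = n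
        · subst h; simp
        · have : (n : ℤ) - k ≠ 0 := by omega
          simp [h, this]
      simp only [h2, tsum_ite_eq]
    have e2 : ∑' p, G p = c n := by
      rw [← Finset.HasAntidiagonal.sigmaAntidiagonalEquivProd.tsum_eq G]
      have hG' := Finset.HasAntidiagonal.sigmaAntidiagonalEquivProd.summable_iff.2 hG
      have := hG'.tsum_sigma' (fun k => hG'.sigma_factor k)
      simp only [Function.comp_apply] at this
      rw [this]
      have h2 : ∀ m, ∑' p : Finset.HasAntidiagonal.antidiagonal m, G (Finset.HasAntidiagonal.sigmaAntidiagonalEquivProd ⟨m, p⟩) =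
          if m = 0 then c n else 0 := by
        intro m
        rw [tsum_fintype]
        have := Finset.sum_coe_sort (Finset.HasAntidiagonal.antidiagonal m) G
        refine Eq.trans this ?_
        have : ∑ p ∈ Finset.HasAntidiagonal.antidiagonal m, G p = ∑ p ∈ Finset.HasAntidiagonal.antidiagonal m, c (n - m) * (r p.1 * d p.2) := by
          refine Finset.sum_congr rfl fun p hp => ?_
          simp only [G, Finset.HasAntidiagonal.mem_antidiagonal.1 hp]
        rw [this, ← Finset.mul_sum, hrd]
        split_ifs with h <;> simp [h]
      simp only [h2, tsum_ite_eq]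
    rw [← e1, e2]
  have := hc.comp_injective (Nat.cast_injective (R := ℤ))
  simpa [Function.comp_def, hdc] using this

namespace CountableChain

/-! ### Kernel powers, first and last visits, and the occupation measure of a cycle -/

section Kernel

variable {S : Type*}

open Classical in
/-- The powers of a nonnegative matrix on a possibly infinite index set. -/
noncomputable def kernelPow (K : S → S → ℝ≥0∞) : ℕ → S → S → ℝ≥0∞
  | 0 => fun x y => if x = y then 1 else 0
  | n + 1 => fun x y => ∑' w, kernelPow K n x w * K w y

open Classical in
/-- The restriction of a matrix to the transitions that do not enter `A`. -/
noncomputable def taboo (K : S → S → ℝ≥0∞) (A : Set S) (x y : S) : ℝ≥0∞ :=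
  if y ∈ A then 0 else K x y

/-- The probability that the first visit to `z` at a positive time happens at time `n + 1`. -/
noncomputable def firstVisit (K : S → S → ℝ≥0∞) (z : S) (n : ℕ) (x : S) : ℝ≥0∞ :=
  ∑' w, kernelPow (taboo K {z}) n x w * K w z

/-- The probability that `z` is not visited at the times `1, …, n`. -/
noncomputable def survival (K : S → S → ℝ≥0∞) (z : S) (n : ℕ) (x : S) : ℝ≥0∞ :=
  ∑' y, kernelPow (taboo K {z}) n x y

variable (K : S → S → ℝ≥0∞) (z : S)

theorem taboo_empty : taboo K ∅ = K := by
  ext x y; simp [taboo]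

theorem kernelPow_zero_self (x : S) : kernelPow K 0 x x = 1 := by simp [kernelPow]

theorem kernelPow_zero_of_ne {x y : S} (h : x ≠ y) : kernelPow K 0 x y = 0 := by
  simp [kernelPow, h]

theorem kernelPow_succ (n : ℕ) (x y : S) :
    kernelPow K (n + 1) x y = ∑' w, kernelPow K n x w * K w y := rfl

theorem tsum_kernelPow_zero_mul (x : S) (h : S → ℝ≥0∞) :
    ∑' w, kernelPow K 0 x w * h w = h x := by
  rw [tsum_eq_single x fun w hw => by rw [kernelPow_zero_of_ne K hw.symm, zero_mul],
    kernelPow_zero_self, one_mul]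

theorem kernelPow_one (x y : S) : kernelPow K 1 x y = K x y :=
  tsum_kernelPow_zero_mul K x fun w => K w y

theorem tsum_mul_tsum_mul (a : S → ℝ≥0∞) (b : S → S → ℝ≥0∞) (c : S → ℝ≥0∞) :
    ∑' w, (∑' v, a v * b v w) * c w = ∑' v, a v * ∑' w, b v w * c w := by
  simp_rw [← ENNReal.tsum_mul_right, ← ENNReal.tsum_mul_left]
  rw [ENNReal.tsum_comm]
  simp_rw [mul_assoc]

theorem kernelPow_add (m n : ℕ) (x y : S) :
    kernelPow K (m + n) x y = ∑' w, kernelPow K m x w * kernelPow K n w y := by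
  induction n generalizing y with
  | zero =>
    rw [tsum_eq_single y fun w hw => by rw [kernelPow_zero_of_ne K hw, mul_zero],
      kernelPow_zero_self, mul_one, add_zero]
  | succ n ih =>
    rw [← add_assoc, kernelPow_succ]
    simp_rw [ih, kernelPow_succ]
    exact tsum_mul_tsum_mul _ _ _

theorem kernelPow_succ' (n : ℕ) (x y : S) :
    kernelPow K (n + 1) x y = ∑' w, K x w * kernelPow K n w y := by
  rw [add_comm, kernelPow_add]
  simp_rw [kernelPow_one]

theorem tsum_kernelPow (hK : ∀ x, ∑' y, K x y = 1) (n : ℕ) (x : S) :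
    ∑' y, kernelPow K n x y = 1 := by
  induction n with
  | zero => simpa using tsum_kernelPow_zero_mul K x fun _ => 1
  | succ n ih =>
    simp_rw [kernelPow_succ]
    rw [ENNReal.tsum_comm]
    simp_rw [ENNReal.tsum_mul_left, hK, mul_one, ih]

theorem kernelPow_le_one (hK : ∀ x, ∑' y, K x y = 1) (n : ℕ) (x y : S) :
    kernelPow K n x y ≤ 1 :=
  (tsum_kernelPow K hK n x).symm ▸ ENNReal.le_tsum y

theorem kernelPow_taboo_succ_self (n : ℕ) (x : S) :
    kernelPow (taboo K {z}) (n + 1) x z = 0 := by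
  simp [kernelPow_succ, taboo]

theorem kernelPow_taboo_succ_of_ne (n : ℕ) (x : S) {y : S} (hy : y ≠ z) :
    kernelPow (taboo K {z}) (n + 1) x y = ∑' w, kernelPow (taboo K {z}) n x w * K w y := by
  simp [kernelPow_succ, taboo, hy]

/-- An unrestricted step after an excursion off `z` either stays off `z` or completes the first
visit; `kernelPow K 0 z y` serves as the Kronecker delta at `z`. -/
theorem tsum_kernelPow_taboo_mul (n : ℕ) (x y : S) :
    ∑' w, kernelPow (taboo K {z}) n x w * K w y =
      kernelPow (taboo K {z}) (n + 1) x y + firstVisit K z n x * kernelPow K 0 z y := by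
  by_cases hy : y = z
  · subst hy
    rw [kernelPow_taboo_succ_self, kernelPow_zero_self, zero_add, mul_one, firstVisit]
  · rw [kernelPow_taboo_succ_of_ne K z n x hy, kernelPow_zero_of_ne K (Ne.symm hy), mul_zero,
      add_zero]

theorem tsum_sum_mul (s : Finset ℕ) (c : ℕ → ℝ≥0∞) (a : ℕ → S → ℝ≥0∞) (b : S → ℝ≥0∞) :
    ∑' w, (∑ i ∈ s, c i * a i w) * b w = ∑ i ∈ s, c i * ∑' w, a i w * b w := by
  simp_rw [Finset.sum_mul]
  rw [Summable.tsum_finsetSum fun _ _ => ENNReal.summable]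
  simp_rw [mul_assoc, ENNReal.tsum_mul_left]

/-- Decomposition of the transition probabilities at the first visit to `z`. -/
theorem kernelPow_eq_first_entrance (n : ℕ) (x y : S) :
    kernelPow K n x y = kernelPow (taboo K {z}) n x y +
      ∑ i ∈ Finset.range n, firstVisit K z i x * kernelPow K (n - 1 - i) z y := by
  induction n generalizing y with
  | zero => simp [kernelPow]
  | succ n ih =>
    rw [kernelPow_succ]
    simp_rw [ih, add_mul]
    rw [ENNReal.tsum_add, tsum_kernelPow_taboo_mul, tsum_sum_mul, Finset.sum_range_succ, add_assoc]
    congr 1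
    rw [add_comm]
    congr 1
    · refine Finset.sum_congr rfl fun i hi => ?_
      rw [← kernelPow_succ]
      have := Finset.mem_range.1 hi
      congr 2; omega
    · simp

/-- Decomposition of the transition probabilities at the last visit to `z`. -/
theorem kernelPow_eq_last_exit (n : ℕ) (y : S) :
    kernelPow K n z y = ∑ i ∈ Finset.range (n + 1),
      kernelPow K i z z * kernelPow (taboo K {z}) (n - i) z y := by
  induction n generalizing y with
  | zero => simp [kernelPow]
  | succ n ih =>
    by_cases hy : y = z
    · subst hy
      rw [Finset.sum_range_succ, Finset.sum_eq_zero fun i hi => ?_]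
      · simp [kernelPow_zero_self]
      · have := Finset.mem_range.1 hi
        rw [show n + 1 - i = (n - i) + 1 by omega, kernelPow_taboo_succ_self, mul_zero]
    · rw [kernelPow_succ]
      simp_rw [ih]
      rw [tsum_sum_mul, Finset.sum_range_succ _ (n + 1), Nat.sub_self,
        kernelPow_zero_of_ne _ (Ne.symm hy), mul_zero, add_zero]
      refine Finset.sum_congr rfl fun i hi => ?_
      have := Finset.mem_range.1 hi
      rw [← kernelPow_taboo_succ_of_ne K z _ _ hy, show n + 1 - i = (n - i) + 1 by omega]

theorem survival_zero (x : S) : survival K z 0 x = 1 := by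
  simpa [survival] using tsum_kernelPow_zero_mul (taboo K {z}) x fun _ => 1

theorem survival_eq_succ_add (hK : ∀ x, ∑' y, K x y = 1) (n : ℕ) (x : S) :
    survival K z n x = survival K z (n + 1) x + firstVisit K z n x := by
  have h : ∑' y, ∑' w, kernelPow (taboo K {z}) n x w * K w y = survival K z n x := by
    rw [ENNReal.tsum_comm]
    simp_rw [ENNReal.tsum_mul_left, hK, mul_one, survival]
  simp_rw [← h, tsum_kernelPow_taboo_mul]
  rw [ENNReal.tsum_add, ENNReal.tsum_mul_left]
  congr 1
  have := tsum_kernelPow_zero_mul K z fun _ => 1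
  simp only [mul_one] at this
  rw [this, mul_one]

theorem sum_firstVisit_add_survival (hK : ∀ x, ∑' y, K x y = 1) (n : ℕ) (x : S) :
    ∑ i ∈ Finset.range n, firstVisit K z i x + survival K z n x = 1 := by
  induction n with
  | zero => simp [survival_zero]
  | succ n ih =>
    rw [Finset.sum_range_succ, add_assoc, add_comm (firstVisit K z n x),
      ← survival_eq_succ_add K z hK, ih]

theorem survival_le_one (hK : ∀ x, ∑' y, K x y = 1) (n : ℕ) (x : S) : survival K z n x ≤ 1 :=
  sum_firstVisit_add_survival K z hK n x ▸ le_add_self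

theorem tsum_firstVisit_le_one (hK : ∀ x, ∑' y, K x y = 1) (x : S) :
    ∑' n, firstVisit K z n x ≤ 1 := by
  rw [ENNReal.tsum_eq_iSup_nat]
  exact iSup_le fun n => sum_firstVisit_add_survival K z hK n x ▸ le_self_add

/-- Summable survival probabilities tend to zero, so no mass escapes the first visit. -/
theorem tsum_firstVisit_eq_one (hK : ∀ x, ∑' y, K x y = 1) {x : S}
    (h : ∑' n, survival K z n x ≠ ∞) : ∑' n, firstVisit K z n x = 1 := by
  have h1 := (ENNReal.summable (f := fun n => firstVisit K z n x)).hasSum.tendsto_sum_nat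
  have h2 := ENNReal.tendsto_atTop_zero_of_tsum_ne_top h
  have h3 := h1.add h2
  simp_rw [sum_firstVisit_add_survival K z hK, add_zero] at h3
  exact tendsto_nhds_unique h3 tendsto_const_nhds

/-- The renewal equation of the last visits to `z`. -/
theorem sum_kernelPow_mul_survival (hK : ∀ x, ∑' y, K x y = 1) (n : ℕ) :
    ∑ i ∈ Finset.range (n + 1), kernelPow K i z z * survival K z (n - i) z = 1 := by
  rw [← tsum_kernelPow K hK n z]
  simp_rw [kernelPow_eq_last_exit K z n]
  rw [Summable.tsum_finsetSum fun _ _ => ENNReal.summable]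
  simp_rw [ENNReal.tsum_mul_left, survival]

section Stationary

variable {K} {m : S → ℝ≥0∞}

theorem tsum_mul_kernelPow (hm : ∀ y, ∑' x, m x * K x y = m y) (n : ℕ) (y : S) : ∑' x, m x * kernelPow K n x y = m y := by
  induction n generalizing y with
  | zero =>
    rw [tsum_eq_single y fun w hw => by rw [kernelPow_zero_of_ne K hw, mul_zero],
      kernelPow_zero_self, mul_one]
  | succ n ih =>
    simp_rw [kernelPow_succ]
    rw [← tsum_mul_tsum_mul]
    simp_rw [ih, hm]

theorem mul_kernelPow_le (hm : ∀ y, ∑' x, m x * K x y = m y) (n : ℕ) (x y : S) : m x * kernelPow K n x y ≤ m y :=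
  tsum_mul_kernelPow hm n y ▸ ENNReal.le_tsum (f := fun x => m x * kernelPow K n x y) x

theorem pos_of_stationary (hm : ∀ y, ∑' x, m x * K x y = m y)
    (hirr : ∀ x y, ∃ n, kernelPow K n x y ≠ 0) (h1 : ∑' x, m x ≠ 0)
    (y : S) : m y ≠ 0 := by
  obtain ⟨x, hx⟩ : ∃ x, m x ≠ 0 := by
    by_contra! h
    exact h1 (by simp [h])
  obtain ⟨n, hn⟩ := hirr x y
  intro h
  have := mul_kernelPow_le hm n x y
  rw [h, nonpos_iff_eq_zero] at this
  exact mul_ne_zero hx hn this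

/-- The occupation measure of a cycle is minimal among invariant measures with the same mass at `z`:
off `z`, one more step of the partial occupation sums is dominated by one step of `m`. -/
theorem mul_sum_taboo_le (hm : ∀ y, ∑' x, m x * K x y = m y) (n : ℕ) (y : S) :
    m z * ∑ i ∈ Finset.range n, kernelPow (taboo K {z}) i z y ≤ m y := by
  induction n generalizing y with
  | zero => simp
  | succ n ih =>
    rw [Finset.sum_range_succ']
    by_cases hy : y = z
    · subst hy
      simp [kernelPow_taboo_succ_self, kernelPow_zero_self]
    · rw [kernelPow_zero_of_ne _ (Ne.symm hy), add_zero]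
      simp_rw [kernelPow_taboo_succ_of_ne K z _ _ hy]
      rw [← hm y, ← Summable.tsum_finsetSum fun _ _ => ENNReal.summable, ← ENNReal.tsum_mul_left]
      refine ENNReal.tsum_le_tsum fun w => ?_
      rw [← Finset.sum_mul, ← mul_assoc]
      exact mul_le_mul_left (ih w) _

/-- The stationary distribution is the normalized expected occupation measure of a cycle. -/
theorem mul_tsum_taboo_eq (hm : ∀ y, ∑' x, m x * K x y = m y)
    (hirr : ∀ x y, ∃ n, kernelPow K n x y ≠ 0) (hfin : ∀ y, m y ≠ ∞)
    (hK : ∀ x, ∑' y, K x y = 1) (hrec : ∑' n, firstVisit K z n z = 1) (y : S) :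
    m z * ∑' n, kernelPow (taboo K {z}) n z y = m y := by
  set γ : S → ℝ≥0∞ := fun y => m z * ∑' n, kernelPow (taboo K {z}) n z y with hγ
  have hle : ∀ y, γ y ≤ m y := fun y => by
    rw [hγ]
    dsimp only
    rw [ENNReal.tsum_eq_iSup_nat, ENNReal.mul_iSup]
    exact iSup_le fun n => mul_sum_taboo_le z hm n y
  have hγz : γ z = m z := by
    rw [hγ]
    dsimp only
    rw [tsum_eq_single 0 fun n hn => ?_]
    · rw [kernelPow_zero_self, mul_one]
    · obtain ⟨k, rfl⟩ := Nat.exists_eq_succ_of_ne_zero hn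
      exact kernelPow_taboo_succ_self K z k z
  -- A step shifts the occupation sums by one; the mass returning to `z`, in total one by `hrec`,
  -- restores the missing initial term.
  have hγK : ∀ y, ∑' x, γ x * K x y = γ y := by
    intro y
    simp_rw [hγ, mul_assoc]
    rw [ENNReal.tsum_mul_left]
    congr 1
    simp_rw [← ENNReal.tsum_mul_right]
    rw [ENNReal.tsum_comm]
    simp_rw [tsum_kernelPow_taboo_mul]
    rw [ENNReal.tsum_add, ENNReal.tsum_mul_right, hrec, one_mul,
      tsum_eq_zero_add' (f := fun n => kernelPow (taboo K {z}) n z y) ENNReal.summable,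
      add_comm]
    simp [kernelPow]
  -- A strict deficit of `γ` at `y` would be carried to `z` by a path of positive probability,
  -- contradicting `γ z = m z`.
  obtain ⟨n, hn⟩ := hirr y z
  have hp : kernelPow K n y z ≠ ∞ := ne_top_of_le_ne_top ENNReal.one_ne_top (kernelPow_le_one K hK n y z)
  by_contra hne
  have hlt : γ y * kernelPow K n y z < m y * kernelPow K n y z :=
    ENNReal.mul_lt_mul_left hn hp (lt_of_le_of_ne (hle y) hne)
  have := ENNReal.tsum_lt_tsum (f := fun x => γ x * kernelPow K n x z)
    (g := fun x => m x * kernelPow K n x z) (i := y)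
    (by rw [tsum_mul_kernelPow hγK, hγz]; exact hfin z)
    (fun x => mul_le_mul_left (hle x) _) hlt
  rw [tsum_mul_kernelPow hγK, tsum_mul_kernelPow hm, hγz] at this
  exact lt_irrefl _ this

end Stationary

end Kernel

/-! ### From the chain to its kernel -/

section Chain

variable {S Ω : Type*}

theorem lt_returnTime_iff (X : ℕ → Ω → S) (z : S) (ω : Ω) (n : ℕ) :
    (n : ℕ∞) < returnTime X z ω ↔ ∀ k, 1 ≤ k → k ≤ n → X k ω ∉ ({z} : Set S) := by
  have h : returnTime X z ω ≤ (n : ℕ∞) ↔ ∃ j ∈ Set.Icc 1 n, X j ω ∈ ({z} : Set S) :=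
    hittingAfter_le_iff
  rw [← not_le, h]
  simp

/-- At most `t` terms, each at most `t`; this turns the second moment of the return time into a
first moment of its tail. -/
theorem tsum_lt_le_sq (t : ℕ∞) :
    ∑' j : ℕ, (if (j : ℕ∞) < t then (j : ℝ≥0∞) else 0) ≤ (t : ℝ≥0∞) ^ 2 := by
  induction t with
  | top => simp
  | coe m =>
    rw [tsum_eq_sum (s := Finset.range m) fun j hj => by
      have := Finset.mem_range.not.1 hj
      simp [this]]
    calc _ ≤ ∑ j ∈ Finset.range m, (m : ℝ≥0∞) := Finset.sum_le_sum fun j hj => by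
          have := Finset.mem_range.1 hj
          split_ifs
          · exact_mod_cast this.le
          · exact zero_le
      _ = _ := by simp [sq]

theorem IsTransitionMatrix.tsum_ofReal {P : S → S → ℝ} (hP : IsTransitionMatrix P) (x : S) :
    ∑' y, ENNReal.ofReal (P x y) = 1 := by
  rw [← ENNReal.ofReal_tsum_of_nonneg (hP.nonneg x) (hP.row_sum x).summable,
    (hP.row_sum x).tsum_eq, ENNReal.ofReal_one]

theorem IsStationary.tsum_ofReal {P : S → S → ℝ} {π : S → ℝ} (hπ : IsStationary P π) :
    ∑' y, ENNReal.ofReal (π y) = 1 := by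
  rw [← ENNReal.ofReal_tsum_of_nonneg hπ.nonneg hπ.hasSum_one.summable,
    hπ.hasSum_one.tsum_eq, ENNReal.ofReal_one]

theorem IsStationary.tsum_ofReal_mul {P : S → S → ℝ} {π : S → ℝ} (hP : IsTransitionMatrix P)
    (hπ : IsStationary P π) (y : S) :
    ∑' x, ENNReal.ofReal (π x) * ENNReal.ofReal (P x y) = ENNReal.ofReal (π y) := by
  simp_rw [← ENNReal.ofReal_mul (hπ.nonneg _)]
  rw [← ENNReal.ofReal_tsum_of_nonneg (fun x => mul_nonneg (hπ.nonneg x) (hP.nonneg x y))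
    (hπ.stationary y).summable, (hπ.stationary y).tsum_eq]

variable [MeasurableSpace Ω] [MeasurableSpace S] [DiscreteMeasurableSpace S]
  {P : S → S → ℝ} {X : ℕ → Ω → S} {μ : S → Measure Ω}

theorem IsMarkovChain.measurable_lt_returnTime (hX : IsMarkovChain P X μ) (z : S) (n : ℕ) :
    MeasurableSet {ω | (n : ℕ∞) < returnTime X z ω} := by
  have : {ω | (n : ℕ∞) < returnTime X z ω} =
      ⋂ k, ⋂ (_ : 1 ≤ k), ⋂ (_ : k ≤ n), X k ⁻¹' {z}ᶜ := by
    ext ω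
    simp only [Set.mem_ofPred_eq, lt_returnTime_iff]
    simp
  rw [this]
  exact MeasurableSet.iInter fun k => MeasurableSet.iInter fun _ => MeasurableSet.iInter fun _ =>
    hX.measurable k (MeasurableSet.of_discrete)

theorem IsMarkovChain.measurableSet_avoid (hX : IsMarkovChain P X μ) (A : Set S) (n : ℕ) (y : S) :
    MeasurableSet {ω | (∀ k, 1 ≤ k → k ≤ n → X k ω ∉ A) ∧ X n ω = y} := by
  have : {ω | (∀ k, 1 ≤ k → k ≤ n → X k ω ∉ A) ∧ X n ω = y} =
      (⋂ k, ⋂ (_ : 1 ≤ k), ⋂ (_ : k ≤ n), X k ⁻¹' Aᶜ) ∩ X n ⁻¹' {y} := by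
    ext ω; simp
  rw [this]
  exact (MeasurableSet.iInter fun k => MeasurableSet.iInter fun _ => MeasurableSet.iInter fun _ =>
    hX.measurable k (MeasurableSet.of_discrete)).inter (hX.measurable n (measurableSet_singleton y))

variable [Countable S]

/-- The Markov property for an event that depends on `X 0, …, X n` and fixes `X n = w`. -/
theorem IsMarkovChain.measure_path_inter (hX : IsMarkovChain P X μ) (x : S) (n : ℕ)
    (C : Set (Fin (n + 1) → S)) (w y : S) (hC : ∀ s ∈ C, s (Fin.last n) = w) :
    μ x ({ω | (fun k : Fin (n + 1) => X k ω) ∈ C} ∩ {ω | X (n + 1) ω = y}) =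
      μ x {ω | (fun k : Fin (n + 1) => X k ω) ∈ C} * ENNReal.ofReal (P w y) := by
  have hpath : Measurable fun ω => fun k : Fin (n + 1) => X k ω :=
    measurable_pi_lambda _ fun k => hX.measurable k
  have hms : ∀ s : Fin (n + 1) → S, MeasurableSet {ω | (fun k : Fin (n + 1) => X k ω) = s} :=
    fun s => hpath (measurableSet_singleton s)
  have hmy : MeasurableSet {ω | X (n + 1) ω = y} := hX.measurable _ (measurableSet_singleton y)
  have hdisj : C.PairwiseDisjoint fun s => {ω | (fun k : Fin (n + 1) => X k ω) = s} := by
    intro s _ s' _ hne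
    exact Set.disjoint_left.2 fun ω h h' => hne (h.symm.trans h')
  have hU : {ω | (fun k : Fin (n + 1) => X k ω) ∈ C} =
      ⋃ s ∈ C, {ω | (fun k : Fin (n + 1) => X k ω) = s} := by
    ext ω; simp
  rw [hU, Set.iUnion₂_inter, measure_biUnion C.to_countable
    (hdisj.mono fun s => Set.inter_subset_left) fun s _ => (hms s).inter hmy,
    measure_biUnion C.to_countable hdisj fun s _ => hms s, ← ENNReal.tsum_mul_right]
  refine tsum_congr fun s => ?_
  let s' : ℕ → S := fun k => if h : k < n + 1 then (s : Fin (n + 1) → S) ⟨k, h⟩ else w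
  have hs' : ∀ ω, (∀ k ≤ n, X k ω = s' k) ↔ (fun k : Fin (n + 1) => X k ω) = s := by
    intro ω
    constructor
    · intro h
      ext k
      exact (h k (Nat.lt_succ_iff.1 k.2)).trans (dif_pos k.2)
    · intro h k hk
      have := congrFun h ⟨k, Nat.lt_succ_iff.2 hk⟩
      simp only [s', dif_pos (Nat.lt_succ_iff.2 hk)]
      exact this
  have hlast : s' n = w := by
    have := hC s s.2
    simpa [s', Fin.last] using this
  have := hX.markov x n s' y
  simp_rw [hs', hlast] at this
  exact this

/-- Avoidance starts at time 1, matching `taboo`, which forbids entering `A` but not starting there.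
The case `A = ∅` gives the transition probabilities and `A = {z}` the law before the return to `z`.
-/
theorem IsMarkovChain.measure_avoid (hX : IsMarkovChain P X μ) (A : Set S) (n : ℕ) (x y : S) :
    μ x {ω | (∀ k, 1 ≤ k → k ≤ n → X k ω ∉ A) ∧ X n ω = y} =
      kernelPow (taboo (fun x y => ENNReal.ofReal (P x y)) A) n x y := by
  have := hX.isProbabilityMeasure x
  induction n generalizing y with
  | zero =>
    by_cases h : x = y
    · subst h
      rw [kernelPow_zero_self, ← mem_ae_iff_prob_eq_one (hX.measurableSet_avoid A 0 x)]
      filter_upwards [hX.start x] with ω hω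
      exact ⟨fun k h1 h2 => absurd h1 (by omega), hω⟩
    · rw [kernelPow_zero_of_ne _ h, measure_eq_zero_iff_ae_notMem]
      filter_upwards [hX.start x] with ω hω hω'
      exact h (hω.symm.trans hω'.2)
  | succ n ih =>
    rw [kernelPow_succ]
    by_cases hy : y ∈ A
    · simp only [taboo, hy, if_true, mul_zero, tsum_zero]
      convert measure_empty (μ := μ x)
      ext ω
      simp only [Set.mem_ofPred_eq, Set.mem_empty_iff_false, iff_false, not_and]
      rintro h rfl
      exact h (n + 1) (by omega) le_rfl hy
    · have hU : {ω | (∀ k, 1 ≤ k → k ≤ n + 1 → X k ω ∉ A) ∧ X (n + 1) ω = y} =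
          ⋃ w, {ω | (∀ k, 1 ≤ k → k ≤ n → X k ω ∉ A) ∧ X n ω = w} ∩ {ω | X (n + 1) ω = y} := by
        ext ω
        simp only [Set.mem_ofPred_eq, Set.mem_iUnion, Set.mem_inter_iff]
        constructor
        · rintro ⟨h, h'⟩
          exact ⟨_, ⟨fun k h1 h2 => h k h1 (by omega), rfl⟩, h'⟩
        · rintro ⟨w, ⟨h, -⟩, rfl⟩
          refine ⟨fun k h1 h2 => ?_, rfl⟩
          rcases Nat.le_succ_iff.1 h2 with h2 | rfl
          · exact h k h1 h2
          · exact hy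
      have hstep : ∀ w, μ x ({ω | (∀ k, 1 ≤ k → k ≤ n → X k ω ∉ A) ∧ X n ω = w} ∩
          {ω | X (n + 1) ω = y}) =
          μ x {ω | (∀ k, 1 ≤ k → k ≤ n → X k ω ∉ A) ∧ X n ω = w} * ENNReal.ofReal (P w y) := by
        intro w
        have hC : {ω | (∀ k, 1 ≤ k → k ≤ n → X k ω ∉ A) ∧ X n ω = w} =
            {ω | (fun k : Fin (n + 1) => X k ω) ∈ {s : Fin (n + 1) → S |
              (∀ k : Fin (n + 1), 1 ≤ (k : ℕ) → s k ∉ A) ∧ s (Fin.last n) = w}} := by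
          ext ω
          simp only [Set.mem_ofPred_eq, Fin.val_last]
          exact and_congr_left fun _ =>
            ⟨fun h k hk => h k hk (Nat.lt_succ_iff.1 k.2),
              fun h k h1 h2 => h ⟨k, Nat.lt_succ_iff.2 h2⟩ h1⟩
        rw [hC]
        exact hX.measure_path_inter x n _ w y fun s hs => hs.2
      rw [hU, measure_iUnion]
      · refine tsum_congr fun w => ?_
        rw [hstep, ih]
        simp [taboo, hy]
      · intro w w' hne
        exact Set.disjoint_left.2 fun ω h h' => hne (h.1.2.symm.trans h'.1.2)
      · exact fun w => (hX.measurableSet_avoid A n w).inter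
          (hX.measurable _ (measurableSet_singleton y))

theorem IsMarkovChain.measure_eq (hX : IsMarkovChain P X μ) (n : ℕ) (x y : S) :
    μ x {ω | X n ω = y} = kernelPow (fun x y => ENNReal.ofReal (P x y)) n x y := by
  have := hX.measure_avoid ∅ n x y
  simpa [taboo_empty] using this

open Classical in
theorem IsMarkovChain.lintegral_lt_returnTime (hX : IsMarkovChain P X μ) (z : S) (n : ℕ) (x : S)
    (h : S → ℝ≥0∞) :
    ∫⁻ ω, (if (n : ℕ∞) < returnTime X z ω then h (X n ω) else 0) ∂(μ x) =
      ∑' y, kernelPow (taboo (fun x y => ENNReal.ofReal (P x y)) {z}) n x y * h y := by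
  have e : ∀ ω, (if (n : ℕ∞) < returnTime X z ω then h (X n ω) else 0) =
      ∑' y, Set.indicator {ω | (∀ k, 1 ≤ k → k ≤ n → X k ω ∉ ({z} : Set S)) ∧ X n ω = y}
        (fun _ => h y) ω := by
    intro ω
    rw [tsum_eq_single (X n ω) fun y hy => Set.indicator_of_notMem (fun h' => hy h'.2.symm) _]
    simp only [Set.indicator, lt_returnTime_iff, Set.mem_ofPred_eq, and_true]
  simp_rw [e]
  rw [lintegral_tsum fun y =>
    (measurable_const.indicator (hX.measurableSet_avoid {z} n y)).aemeasurable]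
  refine tsum_congr fun y => ?_
  rw [lintegral_indicator_const (hX.measurableSet_avoid {z} n y), hX.measure_avoid, mul_comm]

theorem IsMarkovChain.lintegral_tsum_lt_returnTime (hX : IsMarkovChain P X μ) (z x : S)
    (h : S → ℝ≥0∞) :
    ∫⁻ ω, ∑' j : ℕ, (if (j : ℕ∞) < returnTime X z ω then (j : ℝ≥0∞) * h (X j ω) else 0) ∂(μ x) =
      ∑' j : ℕ, (j : ℝ≥0∞) *
        ∑' y, kernelPow (taboo (fun x y => ENNReal.ofReal (P x y)) {z}) j x y * h y := by
  have hm : ∀ j : ℕ, Measurable fun ω =>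
      if (j : ℕ∞) < returnTime X z ω then (j : ℝ≥0∞) * h (X j ω) else 0 := fun j =>
    Measurable.ite (hX.measurable_lt_returnTime z j)
      (((Measurable.of_discrete (f := h)).comp (hX.measurable j)).const_mul (j : ℝ≥0∞))
      measurable_const
  rw [lintegral_tsum fun j => (hm j).aemeasurable]
  refine tsum_congr fun j => ?_
  rw [hX.lintegral_lt_returnTime z j x fun y => j * h y, ← ENNReal.tsum_mul_left]
  exact tsum_congr fun y => by ring

theorem IsMarkovChain.tsum_survival_le (hX : IsMarkovChain P X μ) (z x : S) :
    ∑' j : ℕ, (j : ℝ≥0∞) * survival (fun x y => ENNReal.ofReal (P x y)) z j x ≤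
      ∫⁻ ω, (returnTime X z ω : ℝ≥0∞) ^ 2 ∂(μ x) := by
  have := hX.lintegral_tsum_lt_returnTime z x fun _ => 1
  simp only [mul_one] at this
  simp only [survival]
  rw [← this]
  exact lintegral_mono fun ω => tsum_lt_le_sq _

theorem IsMarkovChain.integrable (hX : IsMarkovChain P X μ) (h : S → ℝ) (n : ℕ) (x : S)
    (hfin : ∑' y, kernelPow (fun x y => ENNReal.ofReal (P x y)) n x y * ENNReal.ofReal |h y| ≠ ∞) :
    Integrable (fun ω => h (X n ω)) (μ x) := by
  refine ⟨((Measurable.of_discrete (f := h)).comp (hX.measurable n)).aestronglyMeasurable, ?_⟩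
  have e := lintegral_map (μ := μ x) (Measurable.of_discrete (f := fun y => ‖h y‖ₑ))
    (hX.measurable n)
  rw [lintegral_countable'] at e
  rw [HasFiniteIntegral, ← e]
  refine lt_of_eq_of_lt (tsum_congr fun y => ?_) (lt_top_iff_ne_top.2 hfin)
  rw [Measure.map_apply (hX.measurable n) (measurableSet_singleton y), ← hX.measure_eq, mul_comm,
    Real.enorm_eq_ofReal_abs]
  rfl

theorem IsMarkovChain.integral_eq (hX : IsMarkovChain P X μ) (h : S → ℝ) (n : ℕ) (x : S)
    (hint : Integrable (fun ω => h (X n ω)) (μ x)) :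
    ∫ ω, h (X n ω) ∂(μ x) =
      ∑' y, (kernelPow (fun x y => ENNReal.ofReal (P x y)) n x y).toReal * h y := by
  have hm : AEStronglyMeasurable h (Measure.map (X n) (μ x)) :=
    (Measurable.of_discrete (f := h)).aestronglyMeasurable
  have hi : Integrable h (Measure.map (X n) (μ x)) :=
    (integrable_map_measure hm (hX.measurable n).aemeasurable).2 hint
  rw [← integral_map (hX.measurable n).aemeasurable hm, integral_countable hi]
  refine tsum_congr fun y => ?_
  rw [measureReal_def, Measure.map_apply (hX.measurable n) (measurableSet_singleton y),
    ← hX.measure_eq, smul_eq_mul]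
  rfl

end Chain

end CountableChain

/-! ### Renewal sequences and summability of convolutions -/

theorem PowerSeries.coeff_mul_range {R : Type*} [Semiring R] (n : ℕ) (a b : ℕ → R) :
    PowerSeries.coeff n (PowerSeries.mk a * PowerSeries.mk b) =
      ∑ i ∈ Finset.range (n + 1), a i * b (n - i) := by
  rw [PowerSeries.coeff_mul, Finset.Nat.sum_antidiagonal_eq_sum_range_succ_mk]
  simp

theorem Complex.eq_one_of_norm_eq_one_of_re_eq_one {w : ℂ} (h : ‖w‖ = 1) (hre : w.re = 1) :
    w = 1 := by
  have h1 := Complex.sq_norm w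
  rw [h, Complex.normSq_apply, hre] at h1
  have him : w.im = 0 := by nlinarith
  exact Complex.ext (by simpa using hre) (by simpa using him)

theorem summable_of_summable_nat_mul {r : ℕ → ℝ} (hr0 : ∀ n, 0 ≤ r n)
    (hrs : Summable fun n : ℕ => n * r n) : Summable r := by
  refine Summable.of_norm_bounded_eventually_nat hrs ?_
  filter_upwards [Filter.eventually_ge_atTop 1] with n hn
  rw [Real.norm_of_nonneg (hr0 n)]
  exact le_mul_of_one_le_left (hr0 n) (by exact_mod_cast hn)

section Renewal

variable {u r : ℕ → ℝ}

/-- Abel summation for the tail sums of a probability distribution. -/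
theorem hasSum_sub_mul_pow_succ (hr : Summable r) (hr0 : ∀ n, 0 ≤ r n) (hr1 : r 0 = 1) {ζ : ℂ}
    (hζ : ‖ζ‖ = 1) :
    HasSum (fun n => ((r n - r (n + 1) : ℝ) : ℂ) * ζ ^ (n + 1))
      (1 + (ζ - 1) * ∑' n, (r n : ℂ) * ζ ^ n) := by
  have hs : Summable fun n => (r n : ℂ) * ζ ^ n := by
    refine Summable.of_norm_bounded hr fun n => ?_
    simp [hζ, abs_of_nonneg (hr0 n)]
  have h1 := hs.hasSum.mul_left ζ
  have h2 := (hasSum_nat_add_iff' 1).2 hs.hasSum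
  have e : 1 + (ζ - 1) * ∑' n, (r n : ℂ) * ζ ^ n =
      ζ * ∑' n, (r n : ℂ) * ζ ^ n -
        (∑' n, (r n : ℂ) * ζ ^ n - ∑ i ∈ Finset.range 1, (r i : ℂ) * ζ ^ i) := by
    rw [Finset.sum_range_one, hr1]
    push_cast
    ring
  rw [e]
  refine (h1.sub h2).congr_fun fun n => ?_
  push_cast
  ring

/-- With lifetime law `p (n + 1) = r n - r (n + 1)`, a zero `ζ` forces `∑ p n ζ^n = 1 = ∑ p n`, so
`ζ^n = 1` wherever `p n > 0`. The renewal equation spreads this to all `n` with `u n > 0`,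
aperiodicity gives `ζ = 1`, and there the sum is at least `r 0 = 1`. -/
theorem tsum_mul_pow_ne_zero_of_renewal (hr : Summable r) (hr0 : ∀ n, 0 ≤ r n) (hr1 : r 0 = 1)
    (hra : ∀ n, r (n + 1) ≤ r n) (hu0 : ∀ n, 0 ≤ u n)
    (hv : ∀ n, u (n + 1) = ∑ i ∈ Finset.range (n + 1), (r i - r (i + 1)) * u (n - i))
    (haper : ∀ d : ℕ, (∀ n, 1 ≤ n → 0 < u n → d ∣ n) → d = 1) {ζ : ℂ} (hζ : ‖ζ‖ = 1) :
    ∑' n, (r n : ℂ) * ζ ^ n ≠ 0 := by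
  intro h0
  have hone := hasSum_sub_mul_pow_succ hr hr0 hr1 (ζ := 1) (by simp)
  have hz := hasSum_sub_mul_pow_succ hr hr0 hr1 hζ
  rw [h0, mul_zero, add_zero] at hz
  rw [sub_self, zero_mul, add_zero] at hone
  have hdiff := Complex.hasSum_re (hone.sub hz)
  have hre : ∀ n, (ζ ^ n).re ≤ 1 := fun n => by
    have := Complex.re_le_norm (ζ ^ n)
    simpa [hζ] using this
  have hterm : ∀ n, (((r n - r (n + 1) : ℝ) : ℂ) * 1 ^ (n + 1) -
      ((r n - r (n + 1) : ℝ) : ℂ) * ζ ^ (n + 1)).re = (r n - r (n + 1)) * (1 - (ζ ^ (n + 1)).re) := by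
    intro n
    rw [one_pow, mul_one, Complex.sub_re, Complex.ofReal_re, Complex.re_ofReal_mul]
    ring
  simp only [hterm, sub_self, Complex.zero_re] at hdiff
  have hzero := (hasSum_zero_iff_of_nonneg fun n =>
    mul_nonneg (sub_nonneg.2 (hra n)) (sub_nonneg.2 (hre (n + 1)))).1 hdiff
  have hpow : ∀ i, r i - r (i + 1) ≠ 0 → ζ ^ (i + 1) = 1 := by
    intro i hi
    have h1 := congrFun hzero i
    simp only [Pi.zero_apply, mul_eq_zero, hi, false_or] at h1
    exact Complex.eq_one_of_norm_eq_one_of_re_eq_one (by simp [hζ]) (by linarith)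
  have hu : ∀ n, 0 < u n → ζ ^ n = 1 := by
    intro n
    induction n using Nat.strong_induction_on with
    | _ n ih =>
      intro hn
      rcases n with _ | n
      · simp
      · rw [hv] at hn
        obtain ⟨i, hi, hne⟩ := Finset.exists_ne_zero_of_sum_ne_zero hn.ne'
        have hi' := Finset.mem_range.1 hi
        have h1 := hpow i (left_ne_zero_of_mul hne)
        have h2 := ih (n - i) (by omega)
          (lt_of_le_of_ne (hu0 _) (right_ne_zero_of_mul hne).symm)
        rw [show n + 1 = (i + 1) + (n - i) by omega, pow_add, h1, h2, one_mul]
  have hord := haper (orderOf ζ) fun n _ hn => orderOf_dvd_of_pow_eq_one (hu n hn)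
  have hζ1 : ζ = 1 := orderOf_eq_one_iff.1 hord
  rw [hζ1] at h0
  simp only [one_pow, mul_one] at h0
  rw [← Complex.ofReal_tsum, Complex.ofReal_eq_zero] at h0
  have := hr.le_tsum 0 fun n _ => hr0 n
  linarith

/-- The increments of an aperiodic renewal sequence are absolutely summable if the lifetime has a
finite second moment. -/
theorem summable_abs_renewal_increments (hrs : Summable fun n : ℕ => n * r n)
    (hr0 : ∀ n, 0 ≤ r n) (hr1 : r 0 = 1)
    (hra : ∀ n, r (n + 1) ≤ r n) (hu0 : ∀ n, 0 ≤ u n) (hu1 : ∀ n, u n ≤ 1)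
    (hur : ∀ n, ∑ i ∈ Finset.range (n + 1), u i * r (n - i) = 1)
    (hv : ∀ n, u (n + 1) = ∑ i ∈ Finset.range (n + 1), (r i - r (i + 1)) * u (n - i))
    (haper : ∀ d : ℕ, (∀ n, 1 ≤ n → 0 < u n → d ∣ n) → d = 1) :
    Summable fun n => |PowerSeries.coeff n (PowerSeries.mk u * (1 - PowerSeries.X))| := by
  set d : ℕ → ℝ := fun n => PowerSeries.coeff n (PowerSeries.mk u * (1 - PowerSeries.X)) with hd
  have hdu : PowerSeries.mk d = PowerSeries.mk u * (1 - PowerSeries.X) := by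
    ext n; simp [hd]
  have hone : PowerSeries.mk u * PowerSeries.mk r = PowerSeries.mk 1 := by
    ext n
    rw [PowerSeries.coeff_mul_range, hur]
    simp
  have hrd : PowerSeries.mk r * PowerSeries.mk d = 1 := by
    rw [hdu, ← mul_assoc, mul_comm (PowerSeries.mk r), hone, PowerSeries.mk_one_mul_one_sub_eq_one]
  -- This a priori bound is what allows `d` to be identified with the summable inverse of `r`.
  have hdb : ∀ n, |d n| ≤ 1 := by
    intro n
    rcases n with _ | n
    · simp only [hd, mul_sub, mul_one, map_sub, PowerSeries.coeff_mk, PowerSeries.coeff_zero_mul_X,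
        sub_zero]
      rw [abs_of_nonneg (hu0 0)]
      exact hu1 0
    · simp only [hd, mul_sub, mul_one, map_sub, PowerSeries.coeff_mk, PowerSeries.coeff_succ_mul_X]
      rw [abs_le]
      constructor <;> linarith [hu0 n, hu1 n, hu0 (n + 1), hu1 (n + 1)]
  have hr := summable_of_summable_nat_mul hr0 hrs
  have := summable_norm_of_convolution_eq_delta (r := fun n => (r n : ℂ)) (d := fun n => (d n : ℂ))
    (B := 1) (by simpa [abs_of_nonneg (hr0 _)] using hrs)
    (fun ζ hζ => tsum_mul_pow_ne_zero_of_renewal hr hr0 hr1 hra hu0 hv haper hζ)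
    (by simpa using hdb) (fun n => by
      have := congrArg (PowerSeries.coeff n) hrd
      rw [PowerSeries.coeff_mul, PowerSeries.coeff_one] at this
      simp only [PowerSeries.coeff_mk] at this
      have h := congrArg (fun t : ℝ => (t : ℂ)) this
      push_cast at h
      exact h.trans (by split_ifs <;> simp))
  simpa using this

end Renewal

/-- As the total is zero, each partial sum is minus a tail, and summing the absolute tails counts
`|a m|` exactly `m` times. -/
theorem summable_abs_partial_sums {a : ℕ → ℝ} (ha : Summable fun n : ℕ => n * |a n|)
    (ha0 : HasSum a 0) : Summable fun n => |∑ j ∈ Finset.range (n + 1), a j| := by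
  have hF : Summable fun p : ℕ × ℕ => |a (p.1 + p.2 + 1)| := by
    rw [← Finset.HasAntidiagonal.sigmaAntidiagonalEquivProd.summable_iff]
    refine (summable_sigma_of_nonneg fun _ => abs_nonneg _).2 ⟨fun m => (hasSum_fintype _).summable, ?_⟩
    refine ((summable_nat_add_iff 1).2 ha).congr fun m => ?_
    rw [tsum_fintype]
    have h : ∀ p : Finset.HasAntidiagonal.antidiagonal m,
        |a ((Finset.HasAntidiagonal.sigmaAntidiagonalEquivProd ⟨m, p⟩).1 +
          (Finset.HasAntidiagonal.sigmaAntidiagonalEquivProd ⟨m, p⟩).2 + 1)| = |a (m + 1)| :=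
      fun p => by
      have := Finset.HasAntidiagonal.mem_antidiagonal.1 p.2
      show |a (p.1.1 + p.1.2 + 1)| = _
      rw [this]
    refine Eq.symm ((Finset.sum_congr rfl fun p _ => h p).trans ?_)
    rw [Finset.sum_const, Finset.card_univ,
      Fintype.card_coe, Finset.Nat.card_antidiagonal, nsmul_eq_mul]
  refine Summable.of_nonneg_of_le (fun _ => abs_nonneg _) (fun n => ?_) (show Summable fun n => ∑' i, |a (n + i + 1)| from hF.prod)
  have h1 := ha0.summable.sum_add_tsum_nat_add (n + 1)
  rw [ha0.tsum_eq] at h1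
  rw [eq_neg_of_add_eq_zero_left h1, abs_neg]
  have h2 : Summable fun i => |a (n + i + 1)| := hF.prod_factor n
  have h3 : (fun i => a (i + (n + 1))) = fun i => a (n + i + 1) := by
    ext i; congr 1; ring
  rw [h3]
  have h4 := norm_tsum_le_tsum_norm (f := fun i => a (n + i + 1)) (by simpa only [Real.norm_eq_abs] using h2)
  simpa only [Real.norm_eq_abs] using h4

/-- Convolving a sequence with summable increments with one of vanishing sum and finite first
moment gives a summable sequence. -/
theorem summable_abs_convolution {u a : ℕ → ℝ}
    (hd : Summable fun n => |PowerSeries.coeff n (PowerSeries.mk u * (1 - PowerSeries.X))|)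
    (ha : Summable fun n : ℕ => n * |a n|) (ha0 : HasSum a 0) :
    Summable fun n => |∑ i ∈ Finset.range (n + 1), u i * a (n - i)| := by
  set d : ℕ → ℝ := fun n => PowerSeries.coeff n (PowerSeries.mk u * (1 - PowerSeries.X)) with hd'
  set b : ℕ → ℝ := fun n => ∑ j ∈ Finset.range (n + 1), a j with hb
  have hdu : PowerSeries.mk d = PowerSeries.mk u * (1 - PowerSeries.X) := by
    ext n; simp [hd']
  have hba : PowerSeries.mk b * (1 - PowerSeries.X) = PowerSeries.mk a := by
    ext n
    rcases n with _ | n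
    · simp [mul_sub, hb]
    · simp only [mul_sub, mul_one, map_sub, PowerSeries.coeff_mk, PowerSeries.coeff_succ_mul_X, hb]
      rw [Finset.sum_range_succ _ (n + 1)]
      ring
  -- The factor `1 - X` is moved from `b` to `u`: `u * a = u (1 - X) * b = d * b`.
  have h : ∀ n, ∑ i ∈ Finset.range (n + 1), u i * a (n - i) =
      ∑ i ∈ Finset.range (n + 1), d i * b (n - i) := by
    intro n
    rw [← PowerSeries.coeff_mul_range, ← PowerSeries.coeff_mul_range, hdu, ← hba]
    congr 1
    ring
  simp_rw [h]
  exact summable_norm_sum_mul_range_of_summable_norm (f := d) (g := b) hd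
    (summable_abs_partial_sums ha ha0)

/-- The convolution is delayed by one because index `i` of `firstVisit` stands for time `i + 1`. -/
theorem ENNReal.tsum_sum_range_mul (v w : ℕ → ℝ≥0∞) :
    ∑' n, ∑ i ∈ Finset.range n, v i * w (n - 1 - i) = (∑' n, v n) * ∑' n, w n := by
  have h : ∀ n, ∑ i ∈ Finset.range n, v i * w (n - 1 - i) =
      ∑' i, if i < n then v i * w (n - 1 - i) else 0 := by
    intro n
    rw [tsum_eq_sum (s := Finset.range n) fun i hi => if_neg (by simpa using hi)]
    exact Finset.sum_congr rfl fun i hi => (if_pos (Finset.mem_range.1 hi)).symm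
  simp_rw [h]
  rw [ENNReal.tsum_comm, ← ENNReal.tsum_mul_right]
  refine tsum_congr fun i => ?_
  rw [← Summable.sum_add_tsum_nat_add' (f := fun n => if i < n then v i * w (n - 1 - i) else 0)
    (k := i + 1) ENNReal.summable, Finset.sum_eq_zero fun n hn => ?_, zero_add,
    ← ENNReal.tsum_mul_left]
  · refine tsum_congr fun n => ?_
    rw [if_pos (by omega)]
    congr 2; omega
  · have := Finset.mem_range.1 hn
    exact if_neg (by omega)

theorem summable_norm_of_tsum_enorm_ne_top {ι : Type*} {f : ι → ℝ} (h : ∑' i, ‖f i‖ₑ ≠ ∞) :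
    Summable fun i => ‖f i‖ := by
  simpa using ENNReal.summable_toReal h

theorem tsum_comm_of_tsum_enorm_ne_top {α β : Type*} {F : α → β → ℝ}
    (h : ∑' a, ∑' b, ‖F a b‖ₑ ≠ ∞) :
    HasSum (fun a => ∑' b, F a b) (∑' b, ∑' a, F a b) := by
  have hs : Summable fun p : α × β => F p.1 p.2 := by
    refine Summable.of_norm (summable_norm_of_tsum_enorm_ne_top ?_)
    rwa [ENNReal.tsum_prod (f := fun a b => ‖F a b‖ₑ)]
  have h1 := hs.prod
  rw [Summable.tsum_comm' (f := F) hs (fun a => hs.prod_factor a)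
    fun b => hs.prod_symm.prod_factor b]
  exact h1.hasSum

/-! ### Expectations, excursion sums and Poisson's equation -/

namespace CountableChain

section Expectation

variable {S : Type*}

/-- The integral of `h` against the weights `k`. -/
noncomputable def weightedSum (k : S → ℝ≥0∞) (h : S → ℝ) : ℝ :=
  ∑' y, (k y).toReal * h y

theorem enorm_toReal_mul_le (a : ℝ≥0∞) (b : ℝ) : ‖a.toReal * b‖ₑ ≤ a * ‖b‖ₑ := by
  rw [enorm_mul, Real.enorm_of_nonneg ENNReal.toReal_nonneg]
  exact mul_le_mul_left ENNReal.ofReal_toReal_le _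

theorem summable_toReal_mul {k : S → ℝ≥0∞} {h : S → ℝ} (hk : ∑' y, k y * ‖h y‖ₑ ≠ ∞) :
    Summable fun y => (k y).toReal * h y :=
  Summable.of_norm (summable_norm_of_tsum_enorm_ne_top
    (ne_top_of_le_ne_top hk (ENNReal.tsum_le_tsum fun _ => enorm_toReal_mul_le _ _)))

theorem enorm_weightedSum_le (k : S → ℝ≥0∞) (h : S → ℝ) :
    ‖weightedSum k h‖ₑ ≤ ∑' y, k y * ‖h y‖ₑ :=
  enorm_tsum_le_tsum_enorm.trans (ENNReal.tsum_le_tsum fun _ => enorm_toReal_mul_le _ _)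

theorem weightedSum_add {k l : S → ℝ≥0∞} {h : S → ℝ} (hk : ∑' y, k y * ‖h y‖ₑ ≠ ∞)
    (hl : ∑' y, l y * ‖h y‖ₑ ≠ ∞) (hk' : ∀ y, k y ≠ ∞) (hl' : ∀ y, l y ≠ ∞) :
    weightedSum (fun y => k y + l y) h = weightedSum k h + weightedSum l h := by
  rw [weightedSum, weightedSum, weightedSum,
    ← (summable_toReal_mul hk).tsum_add (summable_toReal_mul hl)]
  refine tsum_congr fun y => ?_
  rw [ENNReal.toReal_add (hk' y) (hl' y), add_mul]

theorem weightedSum_sum {s : Finset ℕ} {c : ℕ → ℝ≥0∞} {k : ℕ → S → ℝ≥0∞} {h : S → ℝ}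
    (hk : ∀ i ∈ s, ∑' y, k i y * ‖h y‖ₑ ≠ ∞) (hk' : ∀ i ∈ s, ∀ y, k i y ≠ ∞)
    (hc : ∀ i ∈ s, c i ≠ ∞) :
    weightedSum (fun y => ∑ i ∈ s, c i * k i y) h =
      ∑ i ∈ s, (c i).toReal * weightedSum (k i) h := by
  simp_rw [weightedSum, ← tsum_mul_left]
  rw [← Summable.tsum_finsetSum fun i hi => (summable_toReal_mul (hk i hi)).mul_left _]
  refine tsum_congr fun y => ?_
  rw [ENNReal.toReal_sum fun i hi => ENNReal.mul_ne_top (hc i hi) (hk' i hi y), Finset.sum_mul]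
  exact Finset.sum_congr rfl fun i _ => by rw [ENNReal.toReal_mul, mul_assoc]

theorem hasSum_weightedSum {ι : Type*} {c : ι → ℝ≥0∞} {k : ι → S → ℝ≥0∞} {h : S → ℝ}
    (hfin : ∑' i, ∑' y, c i * k i y * ‖h y‖ₑ ≠ ∞) (hck : ∀ y i, c i * k i y ≠ ∞) :
    HasSum (fun i => (c i).toReal * weightedSum (k i) h)
      (weightedSum (fun y => ∑' i, c i * k i y) h) := by
  have h1 := tsum_comm_of_tsum_enorm_ne_top (F := fun i y => (c i * k i y).toReal * h y)
    (ne_top_of_le_ne_top hfin (ENNReal.tsum_le_tsum fun i => ENNReal.tsum_le_tsum fun y =>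
      enorm_toReal_mul_le _ _))
  have e1 : ∀ i, ∑' y, (c i * k i y).toReal * h y = (c i).toReal * weightedSum (k i) h := by
    intro i
    rw [weightedSum, ← tsum_mul_left]
    exact tsum_congr fun y => by rw [ENNReal.toReal_mul, mul_assoc]
  have e2 : ∑' y, ∑' i, (c i * k i y).toReal * h y = weightedSum (fun y => ∑' i, c i * k i y) h := by
    rw [weightedSum]
    refine tsum_congr fun y => ?_
    rw [tsum_mul_right, ENNReal.tsum_toReal_eq (hck y)]
  simp_rw [e1, e2] at h1
  exact h1

variable {K : S → S → ℝ≥0∞} {h : S → ℝ}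

/-- `E_x h(X n)`. -/
noncomputable def expectAt (K : S → S → ℝ≥0∞) (h : S → ℝ) (n : ℕ) (x : S) : ℝ :=
  weightedSum (kernelPow K n x) h

/-- The expected sum of `|h|` along the path from `x` before the first visit to `z` at a positive
time. -/
noncomputable def cycleSum (K : S → S → ℝ≥0∞) (z : S) (h : S → ℝ) (x : S) : ℝ≥0∞ :=
  ∑' n, ∑' y, kernelPow (taboo K {z}) n x y * ‖h y‖ₑ

theorem kernelPow_taboo_le (z : S) (n : ℕ) (x y : S) :
    kernelPow (taboo K {z}) n x y ≤ kernelPow K n x y := by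
  rw [kernelPow_eq_first_entrance K z n x y]
  exact le_self_add

theorem expectAt_zero (x : S) : expectAt K h 0 x = h x := by
  rw [expectAt, weightedSum, tsum_eq_single x fun y hy => by
    rw [kernelPow_zero_of_ne K hy.symm, ENNReal.toReal_zero, zero_mul], kernelPow_zero_self,
    ENNReal.toReal_one, one_mul]

theorem tsum_kernelPow_taboo_mul_ne_top (hfin : ∀ n x, ∑' y, kernelPow K n x y * ‖h y‖ₑ ≠ ∞)
    (z : S) (n : ℕ) (x : S) : ∑' y, kernelPow (taboo K {z}) n x y * ‖h y‖ₑ ≠ ∞ :=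
  ne_top_of_le_ne_top (hfin n x)
    (ENNReal.tsum_le_tsum fun y => mul_le_mul_left (kernelPow_taboo_le z n x y) _)

theorem kernelPow_ne_top (hK : ∀ x, ∑' y, K x y = 1) (n : ℕ) (x y : S) : kernelPow K n x y ≠ ∞ :=
  ne_top_of_le_ne_top ENNReal.one_ne_top (kernelPow_le_one K hK n x y)

theorem kernelPow_taboo_ne_top (hK : ∀ x, ∑' y, K x y = 1) (z : S) (n : ℕ) (x y : S) :
    kernelPow (taboo K {z}) n x y ≠ ∞ :=
  ne_top_of_le_ne_top (kernelPow_ne_top hK n x y) (kernelPow_taboo_le z n x y)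

theorem firstVisit_ne_top (hK : ∀ x, ∑' y, K x y = 1) (z : S) (n : ℕ) (x : S) :
    firstVisit K z n x ≠ ∞ :=
  ne_top_of_le_ne_top ENNReal.one_ne_top
    ((ENNReal.le_tsum n).trans (tsum_firstVisit_le_one K z hK x))

theorem expectAt_eq_last_exit (hK : ∀ x, ∑' y, K x y = 1)
    (hfin : ∀ n x, ∑' y, kernelPow K n x y * ‖h y‖ₑ ≠ ∞) (z : S) (n : ℕ) :
    expectAt K h n z = ∑ i ∈ Finset.range (n + 1),
      (kernelPow K i z z).toReal * weightedSum (kernelPow (taboo K {z}) (n - i) z) h := by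
  rw [← weightedSum_sum (fun i _ => tsum_kernelPow_taboo_mul_ne_top hfin z _ z)
    (fun i _ y => kernelPow_taboo_ne_top hK z _ z y) fun i _ => kernelPow_ne_top hK i z z, expectAt]
  simp_rw [← kernelPow_eq_last_exit K z n]

theorem expectAt_eq_first_entrance (hK : ∀ x, ∑' y, K x y = 1)
    (hfin : ∀ n x, ∑' y, kernelPow K n x y * ‖h y‖ₑ ≠ ∞) (z : S) (n : ℕ) (x : S) :
    expectAt K h n x = weightedSum (kernelPow (taboo K {z}) n x) h +
      ∑ i ∈ Finset.range n, (firstVisit K z i x).toReal * expectAt K h (n - 1 - i) z := by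
  have e := weightedSum_sum (s := Finset.range n) (c := fun i => firstVisit K z i x)
    (k := fun i => kernelPow K (n - 1 - i) z) (h := h) (fun i _ => hfin _ z)
    (fun i _ y => kernelPow_ne_top hK _ z y) fun i _ => firstVisit_ne_top hK z i x
  simp only [expectAt]
  have hle : ∀ y, ∑ i ∈ Finset.range n, firstVisit K z i x * kernelPow K (n - 1 - i) z y ≤
      kernelPow K n x y := fun y => by
    rw [kernelPow_eq_first_entrance K z n x y]
    exact le_add_self
  rw [← e, ← weightedSum_add (tsum_kernelPow_taboo_mul_ne_top hfin z n x)
    (ne_top_of_le_ne_top (hfin n x) (ENNReal.tsum_le_tsum fun y => mul_le_mul_left (hle y) _))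
    (kernelPow_taboo_ne_top hK z n x)
    fun y => ne_top_of_le_ne_top (kernelPow_ne_top hK n x y) (hle y)]
  simp_rw [← kernelPow_eq_first_entrance K z n x]

/-- After the first visit to `z` the expectations restart from `z`, weighted by visit probabilities
of total mass at most one. -/
theorem tsum_enorm_expectAt_le (hK : ∀ x, ∑' y, K x y = 1)
    (hfin : ∀ n x, ∑' y, kernelPow K n x y * ‖h y‖ₑ ≠ ∞) (z x : S) :
    ∑' n, ‖expectAt K h n x‖ₑ ≤ cycleSum K z h x + ∑' n, ‖expectAt K h n z‖ₑ := by
  calc ∑' n, ‖expectAt K h n x‖ₑ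
      ≤ ∑' n, (∑' y, kernelPow (taboo K {z}) n x y * ‖h y‖ₑ +
          ∑ i ∈ Finset.range n, firstVisit K z i x * ‖expectAt K h (n - 1 - i) z‖ₑ) := by
        refine ENNReal.tsum_le_tsum fun n => ?_
        rw [expectAt_eq_first_entrance hK hfin z n x]
        refine (enorm_add_le _ _).trans (add_le_add (enorm_weightedSum_le _ _) ?_)
        refine (enorm_sum_le _ _).trans (Finset.sum_le_sum fun i _ => enorm_toReal_mul_le _ _)
    _ = cycleSum K z h x + (∑' n, firstVisit K z n x) * ∑' n, ‖expectAt K h n z‖ₑ := by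
        rw [ENNReal.tsum_add, cycleSum,
          ENNReal.tsum_sum_range_mul (fun i => firstVisit K z i x) fun n => ‖expectAt K h n z‖ₑ]
    _ ≤ _ := by
        gcongr
        exact mul_le_of_le_one_left zero_le (tsum_firstVisit_le_one K z hK x)

/-- Reaching `x` at time `m` of a cycle from `z` and continuing is part of that cycle, so finiteness
at `z` passes to every state reached before the return. -/
theorem kernelPow_mul_cycleSum_le (z : S) (m : ℕ) (x : S) :
    kernelPow (taboo K {z}) m z x * cycleSum K z h x ≤ cycleSum K z h z := by
  calc kernelPow (taboo K {z}) m z x * cycleSum K z h x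
      = ∑' n, ∑' y, kernelPow (taboo K {z}) m z x * kernelPow (taboo K {z}) n x y * ‖h y‖ₑ := by
        simp_rw [cycleSum, ← ENNReal.tsum_mul_left, mul_assoc]
    _ ≤ ∑' n, ∑' y, kernelPow (taboo K {z}) (m + n) z y * ‖h y‖ₑ := by
        refine ENNReal.tsum_le_tsum fun n => ENNReal.tsum_le_tsum fun y => mul_le_mul_left ?_ _
        rw [kernelPow_add]
        exact ENNReal.le_tsum
          (f := fun w => kernelPow (taboo K {z}) m z w * kernelPow (taboo K {z}) n w y) x
    _ ≤ cycleSum K z h z :=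
        ENNReal.tsum_comp_le_tsum_of_injective (add_right_injective m)
          fun n => ∑' y, kernelPow (taboo K {z}) n z y * ‖h y‖ₑ

-- One step either hits `z`, starting a fresh cycle, or continues the current excursion. This bound
-- yields the absolute convergence of `P g`.
open Classical in
theorem tsum_mul_cycleSum_le (z x : S) :
    ∑' y, K x y * cycleSum K z h y ≤ K x z * cycleSum K z h z + cycleSum K z h x := by
  calc ∑' y, K x y * cycleSum K z h y
      ≤ ∑' y, ((if y = z then K x z * cycleSum K z h z else 0) +
          taboo K {z} x y * cycleSum K z h y) := by
        refine ENNReal.tsum_le_tsum fun y => ?_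
        by_cases hy : y = z
        · subst hy; simp
        · simp [taboo, hy]
    _ = K x z * cycleSum K z h z + ∑' n, ∑' y, kernelPow (taboo K {z}) (n + 1) x y * ‖h y‖ₑ := by
        rw [ENNReal.tsum_add, tsum_ite_eq]
        congr 1
        simp_rw [cycleSum, ← ENNReal.tsum_mul_left]
        rw [ENNReal.tsum_comm]
        refine tsum_congr fun n => ?_
        rw [ENNReal.tsum_comm]
        simp_rw [kernelPow_succ', ← ENNReal.tsum_mul_right, mul_assoc]
    _ ≤ _ := by
        gcongr
        exact ENNReal.tsum_comp_le_tsum_of_injective (add_left_injective 1)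
          fun n => ∑' y, kernelPow (taboo K {z}) n x y * ‖h y‖ₑ

theorem hasSum_mul_expectAt (hK : ∀ x, ∑' y, K x y = 1)
    (hfin : ∀ n x, ∑' y, kernelPow K n x y * ‖h y‖ₑ ≠ ∞) (n : ℕ) (x : S) :
    HasSum (fun y => (K x y).toReal * expectAt K h n y) (expectAt K h (n + 1) x) := by
  have e : ∑' y, ∑' w, K x y * kernelPow K n y w * ‖h w‖ₑ ≠ ∞ := by
    have := hfin (n + 1) x
    simp_rw [kernelPow_succ', ← ENNReal.tsum_mul_right] at this
    rwa [ENNReal.tsum_comm] at this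
  have hle : ∀ w y, K x y * kernelPow K n y w ≤ kernelPow K (n + 1) x w := fun w y => by
    rw [kernelPow_succ']
    exact ENNReal.le_tsum (f := fun y => K x y * kernelPow K n y w) y
  have := hasSum_weightedSum (c := fun y => K x y) (k := fun y => kernelPow K n y) e
    fun w y => ne_top_of_le_ne_top (kernelPow_ne_top hK (n + 1) x w) (hle w y)
  simp_rw [← kernelPow_succ'] at this
  exact this

/-- If the expectations are absolutely summable, then their sum solves Poisson's equation. -/
theorem poisson_of_tsum_enorm_ne_top (hK : ∀ x, ∑' y, K x y = 1)
    (hfin : ∀ n x, ∑' y, kernelPow K n x y * ‖h y‖ₑ ≠ ∞)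
    {x : S} (hx : ∑' n, ‖expectAt K h n x‖ₑ ≠ ∞)
    (hsum : ∑' y, K x y * ∑' n, ‖expectAt K h n y‖ₑ ≠ ∞) :
    HasSum (fun y => (K x y).toReal * ∑' n, expectAt K h n y) ((∑' n, expectAt K h n x) - h x) := by
  have h1 := tsum_comm_of_tsum_enorm_ne_top (F := fun y n => (K x y).toReal * expectAt K h n y)
    (ne_top_of_le_ne_top hsum (ENNReal.tsum_le_tsum fun y => by
      rw [← ENNReal.tsum_mul_left]
      exact ENNReal.tsum_le_tsum fun n => enorm_toReal_mul_le _ _))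
  simp_rw [tsum_mul_left, (hasSum_mul_expectAt hK hfin _ x).tsum_eq] at h1
  have h2 := (summable_norm_of_tsum_enorm_ne_top hx).of_norm.tsum_eq_zero_add
  rw [expectAt_zero] at h2
  rwa [h2, add_sub_cancel_left]

end Expectation

/-! ### Finiteness and summability from the stationary distribution -/

section Recurrent

variable {S : Type*} {K : S → S → ℝ≥0∞} {h : S → ℝ} {m : S → ℝ≥0∞} {z : S}

theorem tsum_kernelPow_mul_ne_top (hirr : ∀ x y, ∃ n, kernelPow K n x y ≠ 0)
    (hm : ∀ y, ∑' x, m x * K x y = m y) (hm1 : ∑' x, m x = 1) (hmh : ∑' y, m y * ‖h y‖ₑ ≠ ∞)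
    (n : ℕ) (x : S) : ∑' y, kernelPow K n x y * ‖h y‖ₑ ≠ ∞ := by
  have h0 := pos_of_stationary hm hirr (by simp [hm1]) x
  intro htop
  have : m x * ∑' y, kernelPow K n x y * ‖h y‖ₑ ≤ ∑' y, m y * ‖h y‖ₑ := by
    rw [← ENNReal.tsum_mul_left]
    refine ENNReal.tsum_le_tsum fun y => ?_
    rw [← mul_assoc]
    exact mul_le_mul_left (mul_kernelPow_le hm n x y) _
  rw [htop, ENNReal.mul_top h0, top_le_iff] at this
  exact hmh this

theorem mul_cycleSum_eq (hirr : ∀ x y, ∃ n, kernelPow K n x y ≠ 0)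
    (hm : ∀ y, ∑' x, m x * K x y = m y) (hmfin : ∀ y, m y ≠ ∞) (hK : ∀ x, ∑' y, K x y = 1)
    (hrec : ∑' n, firstVisit K z n z = 1) :
    m z * cycleSum K z h z = ∑' y, m y * ‖h y‖ₑ := by
  rw [cycleSum, ENNReal.tsum_comm]
  simp_rw [ENNReal.tsum_mul_right]
  rw [← ENNReal.tsum_mul_left]
  refine tsum_congr fun y => ?_
  rw [← mul_assoc, mul_tsum_taboo_eq z hm hirr hmfin hK hrec]

theorem cycleSum_ne_top (hirr : ∀ x y, ∃ n, kernelPow K n x y ≠ 0)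
    (hm : ∀ y, ∑' x, m x * K x y = m y) (hm1 : ∑' x, m x = 1) (hmfin : ∀ y, m y ≠ ∞)
    (hK : ∀ x, ∑' y, K x y = 1) (hrec : ∑' n, firstVisit K z n z = 1)
    (hmh : ∑' y, m y * ‖h y‖ₑ ≠ ∞) (x : S) : cycleSum K z h x ≠ ∞ := by
  have hpos := pos_of_stationary hm hirr (by simp [hm1])
  have hz : cycleSum K z h z ≠ ∞ := by
    intro htop
    have := mul_cycleSum_eq (h := h) hirr hm hmfin hK hrec
    rw [htop, ENNReal.mul_top (hpos z)] at this
    exact hmh this.symm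
  -- A state of positive stationary mass has positive expected occupation during a cycle.
  obtain ⟨n, hn⟩ : ∃ n, kernelPow (taboo K {z}) n z x ≠ 0 := by
    by_contra! h0
    have := mul_tsum_taboo_eq z hm hirr hmfin hK hrec x
    simp only [h0, tsum_zero, mul_zero] at this
    exact hpos x this.symm
  intro htop
  have := kernelPow_mul_cycleSum_le (K := K) (h := h) z n x
  rw [htop, ENNReal.mul_top hn, top_le_iff] at this
  exact hz this

/-- A function with mean zero under the stationary distribution has mean zero over a cycle. -/
theorem hasSum_weightedSum_taboo (hirr : ∀ x y, ∃ n, kernelPow K n x y ≠ 0)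
    (hm : ∀ y, ∑' x, m x * K x y = m y) (hm1 : ∑' x, m x = 1) (hmfin : ∀ y, m y ≠ ∞)
    (hK : ∀ x, ∑' y, K x y = 1) (hrec : ∑' n, firstVisit K z n z = 1)
    (hmh : ∑' y, m y * ‖h y‖ₑ ≠ ∞) (hmean : ∑' y, (m y).toReal * h y = 0) :
    HasSum (fun n => weightedSum (kernelPow (taboo K {z}) n z) h) 0 := by
  -- The constant weight `m z` makes the occupation weights add up to `m` itself; it is divided out
  -- afterwards.
  have h1 := hasSum_weightedSum (c := fun _ : ℕ => m z)
    (k := fun n => kernelPow (taboo K {z}) n z) (h := h) (by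
      simp_rw [mul_assoc, ENNReal.tsum_mul_left]
      exact ENNReal.mul_ne_top (hmfin z) (cycleSum_ne_top hirr hm hm1 hmfin hK hrec hmh z))
    fun y n => ENNReal.mul_ne_top (hmfin z) (kernelPow_taboo_ne_top hK z n z y)
  simp_rw [ENNReal.tsum_mul_left, mul_tsum_taboo_eq z hm hirr hmfin hK hrec] at h1
  have h0 : (m z).toReal ≠ 0 :=
    ENNReal.toReal_ne_zero.2 ⟨pos_of_stationary hm hirr (by simp [hm1]) z, hmfin z⟩
  have h2 := h1.mul_left (m z).toReal⁻¹
  have e : weightedSum (fun y => m y) h = 0 := hmean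
  simpa [e, h0] using h2

theorem summable_nat_mul_toReal {g : ℕ → ℝ≥0∞} (hg : ∑' n : ℕ, (n : ℝ≥0∞) * g n ≠ ∞) :
    Summable fun n : ℕ => n * (g n).toReal := by
  simpa using ENNReal.summable_toReal hg

theorem tsum_ne_top_of_nat_mul {g : ℕ → ℝ≥0∞} (hg : ∑' n : ℕ, (n : ℝ≥0∞) * g n ≠ ∞)
    (h0 : g 0 ≠ ∞) : ∑' n, g n ≠ ∞ := by
  rw [tsum_eq_zero_add' ENNReal.summable]
  refine ENNReal.add_ne_top.2 ⟨h0, ne_top_of_le_ne_top hg ?_⟩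
  refine le_trans (ENNReal.tsum_le_tsum fun n => ?_)
    (ENNReal.tsum_comp_le_tsum_of_injective (add_left_injective 1) fun n : ℕ => (n : ℝ≥0∞) * g n)
  exact le_mul_of_one_le_left zero_le (by exact_mod_cast Nat.le_add_left 1 n)

/-- The renewal result applies with `u` the return probabilities to `z` and `r` the tail of the
return time, whose decrements are the first-visit probabilities. -/
theorem summable_abs_kernelPow_increments (hK : ∀ x, ∑' y, K x y = 1)
    (hτ : ∑' n : ℕ, (n : ℝ≥0∞) * survival K z n z ≠ ∞)
    (haper : ∀ d : ℕ, (∀ n, 1 ≤ n → kernelPow K n z z ≠ 0 → d ∣ n) → d = 1) :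
    Summable fun n => |PowerSeries.coeff n
      (PowerSeries.mk (fun n => (kernelPow K n z z).toReal) * (1 - PowerSeries.X))| := by
  have hrfin : ∀ n, survival K z n z ≠ ∞ := fun n =>
    ne_top_of_le_ne_top ENNReal.one_ne_top (survival_le_one K z hK n z)
  have hstep : ∀ n, (survival K z n z).toReal - (survival K z (n + 1) z).toReal =
      (firstVisit K z n z).toReal := fun n => by
    rw [survival_eq_succ_add K z hK n z, ENNReal.toReal_add (hrfin _) (firstVisit_ne_top hK z n z)]
    ring
  refine summable_abs_renewal_increments (r := fun n => (survival K z n z).toReal)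
    (summable_nat_mul_toReal hτ) (fun n => ENNReal.toReal_nonneg) (by simp [survival_zero])
    (fun n => ?_) (fun n => ENNReal.toReal_nonneg)
    (fun n => ENNReal.toReal_le_of_le_ofReal zero_le_one (by simpa using kernelPow_le_one K hK n z z))
    (fun n => ?_) (fun n => ?_) (fun d hd => haper d fun n hn h0 => hd n hn ?_)
  · have := hstep n
    have h0 : 0 ≤ (firstVisit K z n z).toReal := ENNReal.toReal_nonneg
    linarith
  · have := congrArg ENNReal.toReal (sum_kernelPow_mul_survival K z hK n)
    rw [ENNReal.toReal_sum fun i _ => ENNReal.mul_ne_top (kernelPow_ne_top hK i z z) (hrfin _)] at this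
    simpa only [ENNReal.toReal_mul, ENNReal.toReal_one] using this
  · simp only [hstep]
    rw [kernelPow_eq_first_entrance K z (n + 1) z z, kernelPow_taboo_succ_self, zero_add,
      ENNReal.toReal_sum fun i _ =>
        ENNReal.mul_ne_top (firstVisit_ne_top hK z i z) (kernelPow_ne_top hK _ z z)]
    simp only [ENNReal.toReal_mul, Nat.add_sub_cancel]
  · exact ENNReal.toReal_pos h0 (kernelPow_ne_top hK n z z)

theorem tsum_enorm_expectAt_self_ne_top (hirr : ∀ x y, ∃ n, kernelPow K n x y ≠ 0)
    (hm : ∀ y, ∑' x, m x * K x y = m y) (hm1 : ∑' x, m x = 1) (hmfin : ∀ y, m y ≠ ∞)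
    (hK : ∀ x, ∑' y, K x y = 1) (hrec : ∑' n, firstVisit K z n z = 1)
    (hmh : ∑' y, m y * ‖h y‖ₑ ≠ ∞) (hmean : ∑' y, (m y).toReal * h y = 0)
    (hτ : ∑' n : ℕ, (n : ℝ≥0∞) * survival K z n z ≠ ∞)
    (hmoment : ∑' n : ℕ, (n : ℝ≥0∞) * ∑' y, kernelPow (taboo K {z}) n z y * ‖h y‖ₑ ≠ ∞)
    (haper : ∀ d : ℕ, (∀ n, 1 ≤ n → kernelPow K n z z ≠ 0 → d ∣ n) → d = 1) :
    ∑' n, ‖expectAt K h n z‖ₑ ≠ ∞ := by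
  have hfin := tsum_kernelPow_mul_ne_top hirr hm hm1 hmh
  have ha : Summable fun n : ℕ => n * |weightedSum (kernelPow (taboo K {z}) n z) h| := by
    have := summable_nat_mul_toReal (g := fun n => ‖weightedSum (kernelPow (taboo K {z}) n z) h‖ₑ)
      (ne_top_of_le_ne_top hmoment (ENNReal.tsum_le_tsum fun n => by
        gcongr
        exact enorm_weightedSum_le _ _))
    simpa using this
  have h1 := summable_abs_convolution (summable_abs_kernelPow_increments hK hτ haper) ha
    (hasSum_weightedSum_taboo hirr hm hm1 hmfin hK hrec hmh hmean)
  simp_rw [← expectAt_eq_last_exit hK hfin z] at h1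
  simp_rw [Real.enorm_eq_ofReal_abs]
  exact h1.tsum_ofReal_ne_top

end Recurrent

end CountableChain

/-! ### The main theorem -/

theorem theorem4 {S Ω : Type*} [Countable S] [MeasurableSpace S] [DiscreteMeasurableSpace S]
    [MeasurableSpace Ω] (P : S → S → ℝ) (X : ℕ → Ω → S) (μ : S → Measure Ω) (π : S → ℝ)
    (hP : CountableChain.IsTransitionMatrix P)
    (hX : CountableChain.IsMarkovChain P X μ)
    (hirr : CountableChain.IsIrreducible X μ)
    (hpos : CountableChain.IsPositiveRecurrent X μ)
    (hπ : CountableChain.IsStationary P π)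
    (f : S → ℝ) (hf : CountableChain.MemL1 π f)
    (hmoment : ∃ z : S,
      CountableChain.MomentCondition X μ (CountableChain.centered π f) z ∧
        ∫⁻ ω, (CountableChain.returnTime X z ω : ℝ≥0∞) ^ 2 ∂(μ z) < ∞)
    (haper : CountableChain.IsAperiodic X μ) :
    (∀ x : S,
      (∀ n : ℕ, Integrable (fun ω => CountableChain.centered π f (X n ω)) (μ x)) ∧
        Summable (fun n : ℕ => |∫ ω, CountableChain.centered π f (X n ω) ∂(μ x)|)) ∧
      CountableChain.SolvesPoisson P (CountableChain.centered π f)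
        (CountableChain.potential X μ (CountableChain.centered π f)) := by
  open CountableChain in
  obtain ⟨z, hmom, hτ2⟩ := hmoment
  set h := centered π f with hh
  let K : S → S → ℝ≥0∞ := fun x y => ENNReal.ofReal (P x y)
  let m : S → ℝ≥0∞ := fun x => ENNReal.ofReal (π x)
  have hK : ∀ x, ∑' y, K x y = 1 := hP.tsum_ofReal
  have hm1 : ∑' x, m x = 1 := hπ.tsum_ofReal
  have hm : ∀ y, ∑' x, m x * K x y = m y := hπ.tsum_ofReal_mul hP
  have hmfin : ∀ y, m y ≠ ∞ := fun y => ENNReal.ofReal_ne_top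
  have hirr' : ∀ x y, ∃ n, kernelPow K n x y ≠ 0 := fun x y => by
    obtain ⟨n, hn⟩ := hirr x y
    exact ⟨n, (hX.measure_eq n x y ▸ hn).ne'⟩
  have hfs : Summable fun x => π x * f x := by
    refine Summable.of_norm (hf.congr fun x => ?_)
    rw [norm_mul, Real.norm_of_nonneg (hπ.nonneg x), Real.norm_eq_abs]
  have hhs : Summable fun x => π x * h x := by
    simp only [hh, centered, mul_sub]
    exact hfs.sub (hπ.hasSum_one.summable.mul_right _)
  have hmean : ∑' y, (m y).toReal * h y = 0 := by
    simp only [m, ENNReal.toReal_ofReal (hπ.nonneg _), hh, centered, mul_sub]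
    rw [hfs.tsum_sub (hπ.hasSum_one.summable.mul_right _), tsum_mul_right,
      hπ.hasSum_one.tsum_eq, one_mul, sub_self]
  have hmh : ∑' y, m y * ‖h y‖ₑ ≠ ∞ := by
    have := hhs.abs.tsum_ofReal_ne_top
    simpa only [m, Real.enorm_eq_ofReal_abs, abs_mul, abs_of_nonneg (hπ.nonneg _),
      ENNReal.ofReal_mul (hπ.nonneg _)] using this
  have hτ : ∑' n : ℕ, (n : ℝ≥0∞) * survival K z n z ≠ ∞ :=
    ((hX.tsum_survival_le z z).trans_lt hτ2).ne
  have hmom' : ∑' n : ℕ, (n : ℝ≥0∞) * ∑' y, kernelPow (taboo K {z}) n z y * ‖h y‖ₑ ≠ ∞ := by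
    have e := hX.lintegral_tsum_lt_returnTime z z fun y => ENNReal.ofReal |h y|
    simp_rw [Real.enorm_eq_ofReal_abs]
    rw [← e]
    exact hmom.ne
  have hrec : ∑' n, firstVisit K z n z = 1 :=
    tsum_firstVisit_eq_one K z hK (tsum_ne_top_of_nat_mul hτ (by simp [survival_zero]))
  have haper' : ∀ d : ℕ, (∀ n, 1 ≤ n → kernelPow K n z z ≠ 0 → d ∣ n) → d = 1 :=
    fun d hd => haper z d fun n hn h0 => hd n hn (hX.measure_eq n z z ▸ h0).ne'
  have hfin := tsum_kernelPow_mul_ne_top hirr' hm hm1 hmh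
  have hz := tsum_enorm_expectAt_self_ne_top hirr' hm hm1 hmfin hK hrec hmh hmean hτ hmom' haper'
  have hcyc := cycleSum_ne_top hirr' hm hm1 hmfin hK hrec hmh
  have hx : ∀ x, ∑' n, ‖expectAt K h n x‖ₑ ≠ ∞ := fun x =>
    ne_top_of_le_ne_top (ENNReal.add_ne_top.2 ⟨hcyc x, hz⟩) (tsum_enorm_expectAt_le hK hfin z x)
  have hint : ∀ x n, Integrable (fun ω => h (X n ω)) (μ x) := fun x n =>
    hX.integrable h n x (by simpa only [Real.enorm_eq_ofReal_abs] using hfin n x)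
  have hE : ∀ x n, ∫ ω, h (X n ω) ∂(μ x) = expectAt K h n x := fun x n =>
    hX.integral_eq h n x (hint x n)
  refine ⟨fun x => ⟨hint x, ?_⟩, fun x => ?_⟩
  · simp_rw [hE]
    exact summable_norm_of_tsum_enorm_ne_top (hx x)
  -- Averaging the bound `cycleSum + const` over one step from `x` stays finite; this domination
  -- justifies exchanging `P` with the series.
  · have hsum : ∑' y, K x y * ∑' n, ‖expectAt K h n y‖ₑ ≠ ∞ := by
      refine ne_top_of_le_ne_top (b := (K x z * cycleSum K z h z + cycleSum K z h x) +
        ∑' n, ‖expectAt K h n z‖ₑ) ?_ ?_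
      · exact ENNReal.add_ne_top.2 ⟨ENNReal.add_ne_top.2
          ⟨ENNReal.mul_ne_top ENNReal.ofReal_ne_top (hcyc z), hcyc x⟩, hz⟩
      · calc _ ≤ ∑' y, K x y * (cycleSum K z h y + ∑' n, ‖expectAt K h n z‖ₑ) :=
              ENNReal.tsum_le_tsum fun y => by
                gcongr
                exact tsum_enorm_expectAt_le hK hfin z y
          _ = ∑' y, K x y * cycleSum K z h y + ∑' n, ‖expectAt K h n z‖ₑ := by
              simp_rw [mul_add]
              rw [ENNReal.tsum_add, ENNReal.tsum_mul_right, hK, one_mul]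
          _ ≤ _ := by
              gcongr
              exact tsum_mul_cycleSum_le z x
    have key := poisson_of_tsum_enorm_ne_top hK hfin (hx x) hsum
    simp only [K, ENNReal.toReal_ofReal (hP.nonneg _ _)] at key
    simp only [potential, hE]
    refine ⟨key.summable, ?_⟩
    rw [key.tsum_eq]
    ring
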